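/- Let $\lambda,c,t,\alpha>0$, $m\in\{0,1\}$ and $n\ge 1$. Let $N(s)$, $s\ge 0$, be a homogeneous Poisson process of rate $\lambda$ with event times $s_1<s_2<\cdots$ and $s_0=0$, and let $\theta_1,\theta_2,\dots$ be i.i.d. angles, independent of $N$, with density $$f_m(\theta)=\frac{\Gamma(m+1)}{\sqrt{\pi}\,\Gamma(m+\frac12)}\sin^{2m}\theta,\qquad \theta\in(0,\pi).$$ For $s>0$ put $$X_m(s)=c\sum_{j=1}^{N(s)+1}(\sigma_j-\sigma_{j-1})\cos\theta_j,\qquad \sigma_j=s_j\ (0\le j\le N(s)),\quad \sigma_{N(s)+1}=s.$$ Let $G=G_\alpha(t)$ be a random time independent of $N$ and $(\theta_j)$, with the Gamma density $\frac{t^\alpha}{\Gamma(\alpha)}s^{\alpha-1}e^{-ts}$, $s>0$. Put $v_0=\frac n2$ and $v_1=n+1$, and suppose that $v_m>\frac\alpha2-1$. Let $Q_n$ be the law of $X_m(G)$ given that $n$ Poisson events have occurred when the motion is observed, that is, for every Borel set $A\subseteq\mathbb R$, $$Q_n(A)=\int_0^\infty P\{X_m(G)\in A\mid N(G)=n,\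 G=s\}\,P\{G\in ds\}$$ (the conditioning on the number of events is done for each fixed value $s$ of the random time, and the result is averaged over the law of $G$). Then: (i) $Q_n$ is absolutely continuous with density $$q(x)=\frac{1}{\Gamma(\frac{\alpha+1}{2})\,B(\frac\alpha2,v_m-\frac\alpha2+1)}\int_0^1 w^{\frac\alpha2-1}(1-w)^{v_m-\frac\alpha2}\,\frac{t}{\sqrt{\pi w}\,c}\left(\frac{t|x|}{2c\sqrt w}\right)^{\frac\alpha2}K_{-\frac\alpha2}\!\left(\frac{t|x|}{c\sqrt w}\right)dw$$ for (almost every) $x\in\mathbb R$, where $B(a,b)=\Gamma(a)\Gamma(b)/\Gamma(a+b)$ and $K_\mu(y)=\int_0^\infty e^{-y\cosh u}\cosh(\mu u)\,du$, $y>0$, is the modified Bessel function of the second kind; (ii) $Q_n$ is the centred Gaussian law with random variance $\frac{2c^2}{t^2}ZW$, where $Z$ and $W$ are independent, $Z$ has the Gamma law with shape $\frac{\alpha+1}{2}$ and rate $1$, and $W$ has the Beta law with parameters $\frac\alpha2$ and $v_m-\frac\alpha2+1$; that is, $Q_n(A)=E\big[\mathcal N\big(0,\tfrac{2c^2}{t^2}ZW\big)(A)\big]$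 for every Borel set $A$. -/

import Mathlib

open MeasureTheory ProbabilityTheory Set
open scoped ENNReal

noncomputable section

/-- The law of the random angle: density
`Γ(ν+1) / (√π Γ(ν+1/2)) * (sin θ)^(2ν)` on `(0, π)`. -/
def angleLaw (ν : ℝ) : Measure ℝ :=
  (volume.restrict (Ioo 0 Real.pi)).withDensity fun θ =>
    ENNReal.ofReal (Real.Gamma (ν + 1) / (Real.sqrt Real.pi * Real.Gamma (ν + 1 / 2)) *
      Real.sin θ ^ (2 * ν))

/-- The instant `s_k` of the `k`-th Poisson event, `s_0 = 0`, when `E 0, E 1, …` are the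
successive waiting times. -/
def arrivalTime {Ω : Type*} (E : ℕ → Ω → ℝ) (k : ℕ) (ω : Ω) : ℝ :=
  ∑ i ∈ Finset.range k, E i ω

/-- `N(t)`: the number of indices `k ≥ 1` with `s_k ≤ t`. -/
def eventCount {Ω : Type*} (E : ℕ → Ω → ℝ) (t : ℝ) (ω : Ω) : ℕ :=
  Set.ncard {k : ℕ | arrivalTime E (k + 1) ω ≤ t}

/-- The endpoints of the successive rectilinear displacements up to time `t`:
`s_0 = 0, s_1, …, s_{N(t)}`, and then `s_{N(t)+1} = t`. -/
def switchTime {Ω : Type*} (E : ℕ → Ω → ℝ) (t : ℝ) (j : ℕ) (ω : Ω) : ℝ :=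
  if j ≤ eventCount E t ω then arrivalTime E j ω else t

/-- The position `X(t) = c ∑_{j=1}^{N(t)+1} (s_j - s_{j-1}) cos θ_j`
(the angle `θ_j` is `θ (j-1)` here). -/
def position {Ω : Type*} (c : ℝ) (E θ : ℕ → Ω → ℝ) (t : ℝ) (ω : Ω) : ℝ :=
  c * ∑ j ∈ Finset.range (eventCount E t ω + 1),
    (switchTime E t (j + 1) ω - switchTime E t j ω) * Real.cos (θ j ω)

/-- The random data of the motion `X_ν`: the waiting times of a homogeneous Poisson process of
rate `lam` (independent, exponential), and, independent of them, independent angles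
with law `angleLaw ν`. -/
structure IsMotionData {Ω : Type*} [MeasurableSpace Ω] (P : Measure Ω) (lam ν : ℝ)
    (E θ : ℕ → Ω → ℝ) : Prop where
  law_wait : ∀ j, HasLaw (E j) (expMeasure lam) P
  indep_wait : iIndepFun E P
  law_angle : ∀ j, HasLaw (θ j) (angleLaw ν) P
  indep_angle : iIndepFun θ P
  indep_wait_angle : IndepFun (fun ω j => E j ω) (fun ω j => θ j ω) P

/-- The probability that the motion, observed at the random time `T`, lies in `A`, given that `n`
Poisson events occurred before the observation:
`∫ P{X(T) ∈ A | N(T) = n, T = s} P{T ∈ ds}`. Here `condDistrib` is the regular conditional law of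
the pair `(N(T), X(T))` given `T`, which is then conditioned on its first entry being `n`. -/
def randomTimeCondProb {Ω : Type*} [MeasurableSpace Ω] (P : Measure Ω) [IsFiniteMeasure P]
    (X : ℝ → Ω → ℝ) (N : ℝ → Ω → ℕ) (T : Ω → ℝ) (n : ℕ) (A : Set ℝ) : ℝ≥0∞ :=
  ∫⁻ s, ProbabilityTheory.cond
      (condDistrib (fun ω => (N (T ω) ω, X (T ω) ω)) T P s)
      {p : ℕ × ℝ | p.1 = n} {p : ℕ × ℝ | p.2 ∈ A} ∂(P.map T)

/-- `v_0 = n / 2`, `v_1 = n + 1`. -/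
def motionIndex (m : Fin 2) (n : ℕ) : ℝ :=
  if m = 0 then (n : ℝ) / 2 else (n : ℝ) + 1

/-- The Macdonald function (modified Bessel function of the second kind)
`K_μ(x) = ∫_0^∞ exp(-x cosh u) cosh(μ u) du`, for `x > 0`. -/
def macdonaldK (μ x : ℝ) : ℝ :=
  ∫ u in Ioi (0 : ℝ), Real.exp (-x * Real.cosh u) * Real.cosh (μ * u)

/-- The density of the motion at a Gamma time. -/
def gammaTimeDensity (c t α v x : ℝ) : ℝ :=
  1 / (Real.Gamma ((α + 1) / 2) * ProbabilityTheory.beta (α / 2) (v - α / 2 + 1)) *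
    ∫ w in (0 : ℝ)..1, w ^ (α / 2 - 1) * (1 - w) ^ (v - α / 2) *
      (t / (Real.sqrt (Real.pi * w) * c)) *
      (t * |x| / (2 * c * Real.sqrt w)) ^ (α / 2) *
      macdonaldK (-(α / 2)) (t * |x| / (c * Real.sqrt w))

end

/-! Two facts carry the theorem.

First, fix `s`. The motion at `s` has made `n` complete displacements and one truncated one. For an
exponential duration, the rate times the tail is the density (`lintegral_tail_expMeasure`). Hence
the rate times the probability of having `n` events and a given position at `s`, as a density in
`s`, is the joint law of time and position after `n + 1` complete displacements
(`lintegral_observed`). So conditioning on `N(s) = n` amounts to conditioning a flight of `n + 1`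
exponential displacements on lasting `s` in total. Averaging over a Gamma time replaces the Gamma
law of that total by another one, which is a reweighting by a ratio of Gamma densities
(`gammaTimeLaw`, `lintegral_observed_cond`).

Second, the reweighted law is identified by its moments. The factor `x ^ j` turns an exponential
density into a multiple of a Gamma density. Therefore the `k`-th moment is `k!` times the `k`-th
coefficient of the `(n + 1)`-st power of the moment series of the cosine, times explicit Gamma
factors (`integral_flightLaw`, `integral_pow_gammaTimeLaw`). That series is `(1 - X²)^(-1/2)` for `m
= 0` and the Catalan series at `X²/4` for `m = 1`. In both cases the coefficients of its powers
satisfy a first-order recurrence (`coeff_even_momentSeries_pow_succ`), which becomes the recurrence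
of the even moments of the Gaussian mixture. Odd moments vanish on both sides. Exponential moments
exist near `0`, so the moments determine the law (`Measure.ext_of_moments`), and (ii) follows.

For (i), integrating the Gaussian density against the Gamma factor of the variance produces the
Macdonald function (`lintegral_gaussianPDF_gammaMeasure`); the Beta factor remains as the integral
over `w`. -/

/-! ### Determination of a law by its moments -/

/-- Two finite measures on `ℝ` with finite exponential moments near `0` and the same moments
are equal. -/
theorem MeasureTheory.Measure.ext_of_moments {μ ν : Measure ℝ} [IsFiniteMeasure μ]
    [IsFiniteMeasure ν] (hμ : 0 ∈ interior (integrableExpSet id μ))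
    (hν : 0 ∈ interior (integrableExpSet id ν)) (h : ∀ k : ℕ, ∫ x, x ^ k ∂μ = ∫ x, x ^ k ∂ν) :
    μ = ν := by
  -- A vertical strip around the imaginary axis on which both complex moment generating functions
  -- are analytic. It is convex, hence connected, and the identity theorem applies.
  set U : Set ℂ := {z | z.re ∈ interior (integrableExpSet id μ) ∩ interior (integrableExpSet id ν)}
  have hf : AnalyticOnNhd ℂ (complexMGF id μ) U := analyticOnNhd_complexMGF.mono fun z hz => hz.1
  have hg : AnalyticOnNhd ℂ (complexMGF id ν) U := analyticOnNhd_complexMGF.mono fun z hz => hz.2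
  have hU : IsPreconnected U :=
    ((convex_integrableExpSet.interior.inter convex_integrableExpSet.interior).linear_preimage
      Complex.reLm).isPreconnected
  have h0 : (0 : ℂ) ∈ U := ⟨by simpa using hμ, by simpa using hν⟩
  have hd : ∀ k, iteratedDeriv k (complexMGF id μ) 0 = iteratedDeriv k (complexMGF id ν) 0 := by
    intro k
    rw [iteratedDeriv_complexMGF (by simpa using hμ), iteratedDeriv_complexMGF (by simpa using hν)]
    have := congrArg (fun r : ℝ => (r : ℂ)) (h k)
    simp only [← integral_complex_ofReal] at this
    simpa using this
  have hev : complexMGF id μ =ᶠ[nhds 0] complexMGF id ν := by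
    have h1 := (hf 0 h0).hasFPowerSeriesAt
    have h2 := (hg 0 h0).hasFPowerSeriesAt
    have : (fun n : ℕ => iteratedDeriv n (complexMGF id μ) 0 / (n.factorial : ℂ)) =
        fun n : ℕ => iteratedDeriv n (complexMGF id ν) 0 / (n.factorial : ℂ) := by
      funext k; rw [hd k]
    rw [this] at h1
    have h3 := h1.sub h2
    rw [sub_self] at h3
    filter_upwards [h3.eventually_eq_zero] with z hz
    exact sub_eq_zero.1 hz
  have heq := hf.eqOn_of_preconnected_of_eventuallyEq hg hU h0 hev
  -- The strip contains the imaginary axis, where the complex moment generating function is the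
  -- characteristic function.
  refine Measure.ext_of_charFun (funext fun t => ?_)
  rw [← Measure.map_id (μ := μ), ← Measure.map_id (μ := ν), ← complexMGF_mul_I aemeasurable_id,
    ← complexMGF_mul_I aemeasurable_id]
  exact heq ⟨by simpa using hμ, by simpa using hν⟩

theorem MeasureTheory.Measure.ext_of_mgf_eventuallyEq {μ ν : Measure ℝ} [IsFiniteMeasure μ]
    [IsFiniteMeasure ν] (hμ : 0 ∈ interior (integrableExpSet id μ))
    (hν : 0 ∈ interior (integrableExpSet id ν)) (h : mgf id μ =ᶠ[nhds 0] mgf id ν) : μ = ν := by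
  refine Measure.ext_of_moments hμ hν fun k => ?_
  have := (h.iteratedDeriv_eq k)
  rw [iteratedDeriv_mgf_zero hμ, iteratedDeriv_mgf_zero hν] at this
  simpa using this

/-! ### Changes of density -/

section Tilt

variable {p q h g : ℝ → ℝ} {C : ℝ}

/-- Powers, exponentials and ratios of densities all act on the laws below through this rule: a
factor `h` in the integrand is absorbed in the density. -/
theorem integral_withDensity_tilt (hp : Measurable p) (hp0 : ∀ x, 0 ≤ p x) (hq : Measurable q)
    (hq0 : ∀ x, 0 ≤ q x) (H : ∀ᵐ x, p x * h x = C * q x) :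
    ∫ x, h x * g x ∂(volume.withDensity fun x => ENNReal.ofReal (p x)) =
      C * ∫ x, g x ∂(volume.withDensity fun x => ENNReal.ofReal (q x)) := by
  rw [integral_withDensity_eq_integral_toReal_smul (by fun_prop) (by simp),
    integral_withDensity_eq_integral_toReal_smul (by fun_prop) (by simp), ← integral_const_mul]
  refine integral_congr_ae ?_
  filter_upwards [H] with x hx
  simp only [ENNReal.toReal_ofReal (hp0 x), ENNReal.toReal_ofReal (hq0 x), smul_eq_mul]
  rw [← mul_assoc, hx, mul_assoc]

theorem integrable_withDensity_tilt (hp : Measurable p) (hp0 : ∀ x, 0 ≤ p x) (hq : Measurable q)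
    (hq0 : ∀ x, 0 ≤ q x) (hC : C ≠ 0) (H : ∀ᵐ x, p x * h x = C * q x) :
    Integrable (fun x => h x * g x) (volume.withDensity fun x => ENNReal.ofReal (p x)) ↔
      Integrable g (volume.withDensity fun x => ENNReal.ofReal (q x)) := by
  rw [integrable_withDensity_iff_integrable_smul' (by fun_prop) (by simp),
    integrable_withDensity_iff_integrable_smul' (by fun_prop) (by simp),
    ← integrable_const_mul_iff (IsUnit.mk0 C hC) fun x => (ENNReal.ofReal (q x)).toReal • g x]
  refine integrable_congr ?_
  filter_upwards [H] with x hx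
  simp only [ENNReal.toReal_ofReal (hp0 x), ENNReal.toReal_ofReal (hq0 x), smul_eq_mul]
  rw [← mul_assoc, hx, mul_assoc]

end Tilt

/-! ### Moments of Gamma and Beta laws -/

namespace ProbabilityTheory

theorem ae_pos_gammaMeasure (a r : ℝ) : ∀ᵐ x ∂gammaMeasure a r, 0 < x := by
  rw [gammaMeasure, ae_withDensity_iff (by unfold gammaPDF; fun_prop)]
  have : ∀ᵐ x : ℝ, x ≠ 0 := by simp [ae_iff]
  filter_upwards [this] with x hx h
  by_contra hlt
  exact h (gammaPDF_of_neg (lt_of_le_of_ne (not_lt.1 hlt) hx))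

theorem gammaPDFReal_mul_pow_mul_exp {a r : ℝ} (ha : 0 < a) (hr : 0 < r) (k : ℕ) {u : ℝ}
    (hu : u < r) : ∀ᵐ x : ℝ, gammaPDFReal a r x * (x ^ k * Real.exp (u * x)) =
      r ^ a * Real.Gamma (a + k) / (Real.Gamma a * (r - u) ^ (a + k)) *
        gammaPDFReal (a + k) (r - u) x := by
  have h0 : ∀ᵐ x : ℝ, x ≠ 0 := by simp [ae_iff]
  filter_upwards [h0] with x hx0
  unfold gammaPDFReal
  split_ifs with hx
  · have hx' : 0 < x := lt_of_le_of_ne hx hx0.symm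
    have hG : 0 < Real.Gamma a := Real.Gamma_pos_of_pos ha
    have hGk : 0 < Real.Gamma (a + k) := Real.Gamma_pos_of_pos (by positivity)
    have hru : 0 < (r - u) ^ (a + k) := Real.rpow_pos_of_pos (sub_pos.2 hu) _
    have e1 : x ^ (a + k - 1) = x ^ (a - 1) * x ^ k := by
      rw [← Real.rpow_natCast x k, ← Real.rpow_add hx']; ring_nf
    have e2 : Real.exp (-((r - u) * x)) = Real.exp (-(r * x)) * Real.exp (u * x) := by
      rw [← Real.exp_add]; ring_nf
    rw [e1, e2]
    field_simp
  · simp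

theorem integrable_pow_mul_exp_mul_gammaMeasure {a r : ℝ} (ha : 0 < a) (hr : 0 < r) (k : ℕ)
    {u : ℝ} (hu : u < r) {g : ℝ → ℝ} :
    Integrable (fun x => x ^ k * Real.exp (u * x) * g x) (gammaMeasure a r) ↔
      Integrable g (gammaMeasure (a + k) (r - u)) := by
  have hak : 0 < a + k := by positivity
  have hru := sub_pos.2 hu
  refine integrable_withDensity_tilt (measurable_gammaPDFReal _ _)
    (gammaPDFReal_nonneg ha hr) (measurable_gammaPDFReal _ _) (gammaPDFReal_nonneg hak hru) ?_
    (gammaPDFReal_mul_pow_mul_exp ha hr k hu)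
  have := Real.Gamma_pos_of_pos ha
  have := Real.Gamma_pos_of_pos hak
  have := Real.rpow_pos_of_pos hru (a + k)
  positivity

theorem integral_pow_mul_exp_mul_gammaMeasure {a r : ℝ} (ha : 0 < a) (hr : 0 < r) (k : ℕ)
    {u : ℝ} (hu : u < r) (g : ℝ → ℝ) :
    ∫ x, x ^ k * Real.exp (u * x) * g x ∂gammaMeasure a r =
      r ^ a * Real.Gamma (a + k) / (Real.Gamma a * (r - u) ^ (a + k)) *
        ∫ x, g x ∂gammaMeasure (a + k) (r - u) :=
  integral_withDensity_tilt (measurable_gammaPDFReal _ _)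
    (gammaPDFReal_nonneg ha hr) (measurable_gammaPDFReal _ _)
    (gammaPDFReal_nonneg (by positivity) (sub_pos.2 hu)) (gammaPDFReal_mul_pow_mul_exp ha hr k hu)

theorem integrable_pow_mul_gammaMeasure {a r : ℝ} (ha : 0 < a) (hr : 0 < r) (k : ℕ)
    {g : ℝ → ℝ} : Integrable (fun x => x ^ k * g x) (gammaMeasure a r) ↔
      Integrable g (gammaMeasure (a + k) r) := by
  simpa using integrable_pow_mul_exp_mul_gammaMeasure (u := 0) ha hr k hr (g := g)

theorem integral_pow_mul_gammaMeasure {a r : ℝ} (ha : 0 < a) (hr : 0 < r) (k : ℕ) (g : ℝ → ℝ) :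
    ∫ x, x ^ k * g x ∂gammaMeasure a r =
      Real.Gamma (a + k) / (Real.Gamma a * r ^ k) * ∫ x, g x ∂gammaMeasure (a + k) r := by
  have := integral_pow_mul_exp_mul_gammaMeasure (u := 0) ha hr k hr g
  simp only [zero_mul, Real.exp_zero, mul_one, sub_zero] at this
  rw [this, Real.rpow_add hr, Real.rpow_natCast]
  have h1 := (Real.Gamma_pos_of_pos ha).ne'
  have h2 := (Real.rpow_pos_of_pos hr a).ne'
  field_simp

theorem integrable_exp_mul_gammaMeasure {a r u : ℝ} (ha : 0 < a) (hr : 0 < r) (hu : u < r) :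
    Integrable (fun x => Real.exp (u * x)) (gammaMeasure a r) := by
  have := isProbabilityMeasure_gammaMeasure (a := a + (0 : ℕ)) (by simpa using ha) (sub_pos.2 hu)
  have h := (integrable_pow_mul_exp_mul_gammaMeasure ha hr 0 hu (g := fun _ => 1)).2
    (integrable_const _)
  simpa using h

theorem zero_mem_interior_integrableExpSet_gammaMeasure {a r : ℝ} (ha : 0 < a) (hr : 0 < r) :
    0 ∈ interior (integrableExpSet id (gammaMeasure a r)) := by
  rw [mem_interior_iff_mem_nhds]
  filter_upwards [Iio_mem_nhds hr] with u hu using integrable_exp_mul_gammaMeasure ha hr hu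

theorem mgf_id_gammaMeasure {a r u : ℝ} (ha : 0 < a) (hr : 0 < r) (hu : u < r) :
    mgf id (gammaMeasure a r) u = (r / (r - u)) ^ a := by
  have := isProbabilityMeasure_gammaMeasure ha (sub_pos.2 hu)
  have h := integral_pow_mul_exp_mul_gammaMeasure ha hr 0 hu (fun _ => 1)
  simp only [pow_zero, one_mul, mul_one, Nat.cast_zero, add_zero, integral_const,
    probReal_univ, smul_eq_mul] at h
  have h1 := (Real.Gamma_pos_of_pos ha).ne'
  rw [mgf, Real.div_rpow hr.le (sub_pos.2 hu).le]
  simp only [id, h]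
  field_simp

theorem integral_pow_gammaMeasure {a r : ℝ} (ha : 0 < a) (hr : 0 < r) (k : ℕ) :
    ∫ x, x ^ k ∂gammaMeasure a r = Real.Gamma (a + k) / (Real.Gamma a * r ^ k) := by
  have := isProbabilityMeasure_gammaMeasure (a := a + k) (by positivity) hr
  simpa using integral_pow_mul_gammaMeasure ha hr k fun _ => 1

/-- The sum of independent Gamma variables with a common rate is Gamma. -/
theorem map_add_prod_gammaMeasure {a b r : ℝ} (ha : 0 < a) (hb : 0 < b) (hr : 0 < r) :
    ((gammaMeasure a r).prod (gammaMeasure b r)).map (fun p => p.1 + p.2) =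
      gammaMeasure (a + b) r := by
  have := isProbabilityMeasure_gammaMeasure ha hr
  have := isProbabilityMeasure_gammaMeasure hb hr
  have := isProbabilityMeasure_gammaMeasure (add_pos ha hb) hr
  have hm : Measurable fun p : ℝ × ℝ => p.1 + p.2 := by fun_prop
  have := Measure.isProbabilityMeasure_map
    (μ := (gammaMeasure a r).prod (gammaMeasure b r)) hm.aemeasurable
  refine Measure.ext_of_mgf_eventuallyEq ?_
    (zero_mem_interior_integrableExpSet_gammaMeasure (add_pos ha hb) hr) ?_
  · rw [mem_interior_iff_mem_nhds]
    filter_upwards [Iio_mem_nhds hr] with u hu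
    simp only [integrableExpSet, mem_ofPred_eq, id]
    rw [integrable_map_measure (by fun_prop) (by fun_prop)]
    simpa [Function.comp_def, mul_add, Real.exp_add] using
      (integrable_exp_mul_gammaMeasure ha hr hu).mul_prod (integrable_exp_mul_gammaMeasure hb hr hu)
  -- The generating functions `(r / (r - u)) ^ a` and `(r / (r - u)) ^ b` multiply, so the shapes
  -- add.
  · filter_upwards [Iio_mem_nhds hr] with u hu
    rw [mgf_id_gammaMeasure (add_pos ha hb) hr hu,
      Real.rpow_add (div_pos hr (sub_pos.2 hu)), ← mgf_id_gammaMeasure ha hr hu,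
      ← mgf_id_gammaMeasure hb hr hu]
    simp only [mgf, id]
    rw [integral_map (by fun_prop) (by fun_prop), ← integral_prod_mul]
    simp [mul_add, Real.exp_add]

theorem integral_pow_betaMeasure {a b : ℝ} (ha : 0 < a) (hb : 0 < b) (k : ℕ) :
    ∫ x, x ^ k ∂betaMeasure a b = beta (a + k) b / beta a b := by
  have := isProbabilityMeasureBeta (α := a + k) (by positivity) hb
  have hnn : ∀ {a' : ℝ}, 0 < a' → ∀ x, 0 ≤ betaPDFReal a' b x := by
    intro a' ha' x
    by_cases hx : 0 < x ∧ x < 1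
    · exact (betaPDFReal_pos hx.1 hx.2 ha' hb).le
    · simp [betaPDFReal, hx]
  have hak : 0 < a + k := by positivity
  have := integral_withDensity_tilt (p := betaPDFReal a b) (q := betaPDFReal (a + k) b)
    (h := fun x => x ^ k) (g := fun _ => 1) (C := beta (a + k) b / beta a b)
    (measurable_betaPDFReal _ _) (hnn ha) (measurable_betaPDFReal _ _) (hnn hak) ?_
  · change ∫ x, x ^ k * 1 ∂betaMeasure a b = _ * ∫ x, 1 ∂betaMeasure (a + k) b at this
    simpa using this
  · refine .of_forall fun x => ?_
    unfold betaPDFReal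
    split_ifs with hx
    · have e1 : x ^ (a + k - 1) = x ^ (a - 1) * x ^ k := by
        rw [← Real.rpow_natCast x k, ← Real.rpow_add hx.1]; ring_nf
      have h1 := beta_pos ha hb
      have h2 := beta_pos hak hb
      rw [e1]
      field_simp
    · simp

theorem ae_mem_Ioo_betaMeasure (a b : ℝ) : ∀ᵐ x ∂betaMeasure a b, x ∈ Ioo (0 : ℝ) 1 := by
  rw [betaMeasure, ae_withDensity_iff (by unfold betaPDF; fun_prop)]
  refine .of_forall fun x h => ?_
  by_contra hx
  exact h (by rw [betaPDF_eq, if_neg (by simpa using hx), ENNReal.ofReal_zero])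

end ProbabilityTheory

/-! ### The flight at its event times -/

noncomputable section

/-- One more displacement: from the current (time, position) and an independent
(duration, velocity) to the next (time, position). -/
def flightStep (p : (ℝ × ℝ) × (ℝ × ℝ)) : ℝ × ℝ := (p.1.1 + p.2.1, p.1.2 + p.2.1 * p.2.2)

/-- The joint law of the `N`-th event time and of the position at that time, when the waiting times
are exponential of rate `r` and the velocities have law `κ`. -/
def flightLaw (r : ℝ) (κ : Measure ℝ) : ℕ → Measure (ℝ × ℝ)
  | 0 => Measure.dirac 0
  | N + 1 => ((flightLaw r κ N).prod ((expMeasure r).prod κ)).map flightStep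

/-- The generating function of the moments of `κ`. -/
def momentSeries (κ : Measure ℝ) : PowerSeries ℝ := PowerSeries.mk fun j => ∫ z, z ^ j ∂κ

end

@[fun_prop]
theorem measurable_flightStep : Measurable flightStep := by unfold flightStep; fun_prop

section

variable {r : ℝ} {κ : Measure ℝ}

theorem isProbabilityMeasure_flightLaw (hr : 0 < r) [IsProbabilityMeasure κ] (N : ℕ) :
    IsProbabilityMeasure (flightLaw r κ N) := by
  have := isProbabilityMeasure_expMeasure hr
  induction N with
  | zero => unfold flightLaw; infer_instance
  | succ N ih => exact Measure.isProbabilityMeasure_map measurable_flightStep.aemeasurable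

theorem flightLaw_one (hr : 0 < r) [IsProbabilityMeasure κ] :
    flightLaw r κ 1 = ((expMeasure r).prod κ).map fun q => (q.1, q.1 * q.2) := by
  have := isProbabilityMeasure_expMeasure hr
  simp only [flightLaw]
  rw [Measure.dirac_prod, Measure.map_map (by fun_prop) (by fun_prop)]
  congr 1
  funext q
  simp [flightStep]

theorem map_fst_flightLaw (hr : 0 < r) [IsProbabilityMeasure κ] (N : ℕ) :
    (flightLaw r κ (N + 1)).map Prod.fst = gammaMeasure (N + 1) r := by
  have := isProbabilityMeasure_expMeasure hr
  induction N with
  | zero =>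
    rw [zero_add, flightLaw_one hr, Measure.map_map (by fun_prop) (by fun_prop)]
    change ((expMeasure r).prod κ).map Prod.fst = _
    rw [Measure.map_fst_prod]
    simp [expMeasure]
  | succ N ih =>
    have := isProbabilityMeasure_flightLaw (κ := κ) hr (N + 1)
    rw [flightLaw, Measure.map_map (by fun_prop) (by fun_prop), Nat.cast_succ,
      ← map_add_prod_gammaMeasure (by positivity) one_pos hr, ← ih, ← expMeasure]
    -- The exponential factor is written as a marginal, so that the sum of times becomes a function
    -- on the product carrying `flightStep`.
    have h1 : expMeasure r = ((expMeasure r).prod κ).map Prod.fst := by simp [Measure.map_fst_prod]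
    conv_rhs => rw [h1]
    rw [Measure.map_prod_map _ _ measurable_fst measurable_fst,
      Measure.map_map (by fun_prop) (by fun_prop)]
    rfl

/-- The speed is at most one. This bound transfers integrability from the Gamma law of the time to
the position. -/
theorem ae_abs_snd_le_fst_flightLaw (hr : 0 < r) [IsProbabilityMeasure κ]
    (hκ : ∀ᵐ z ∂κ, |z| ≤ 1) (N : ℕ) : ∀ᵐ p ∂flightLaw r κ N, |p.2| ≤ p.1 := by
  have := isProbabilityMeasure_expMeasure hr
  induction N with
  | zero =>
    rw [flightLaw, ae_dirac_iff (measurableSet_le (by fun_prop) (by fun_prop))]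
    simp
  | succ N ih =>
    have := isProbabilityMeasure_flightLaw (κ := κ) hr N
    rw [flightLaw, ae_map_iff (by fun_prop) (measurableSet_le (by fun_prop) (by fun_prop))]
    have h1 := Measure.quasiMeasurePreserving_fst (μ := flightLaw r κ N)
      (ν := (expMeasure r).prod κ) |>.ae ih
    have h2 := Measure.quasiMeasurePreserving_snd (μ := flightLaw r κ N)
      (ν := (expMeasure r).prod κ) |>.ae
      (Measure.quasiMeasurePreserving_fst.ae (ae_pos_gammaMeasure 1 r))
    have h3 := Measure.quasiMeasurePreserving_snd (μ := flightLaw r κ N)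
      (ν := (expMeasure r).prod κ) |>.ae (Measure.quasiMeasurePreserving_snd.ae hκ)
    filter_upwards [h1, h2, h3] with p h1 h2 h3
    calc |p.1.2 + p.2.1 * p.2.2| ≤ |p.1.2| + |p.2.1| * |p.2.2| := by
          rw [← abs_mul]; exact abs_add_le _ _
      _ ≤ p.1.1 + p.2.1 * 1 := by
          rw [abs_of_pos h2]
          gcongr
      _ = _ := by simp [flightStep]

/-- Moments of the position weighted by a function of the time. -/
theorem integral_flightLaw (hr : 0 < r) [IsProbabilityMeasure κ]
    (hκ : ∀ᵐ z ∂κ, |z| ≤ 1) (N k : ℕ) {g : ℝ → ℝ} (hg : Measurable g)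
    (hgi : Integrable g (gammaMeasure (N + 1 + k) r)) :
    ∫ p, p.2 ^ k * g p.1 ∂flightLaw r κ (N + 1) =
      k.factorial * (momentSeries κ ^ (N + 1)).coeff k / r ^ k *
        ∫ u, g u ∂gammaMeasure (N + 1 + k) r := by
  have := isProbabilityMeasure_expMeasure hr
  induction N generalizing k g with
  | zero =>
    rw [zero_add, flightLaw_one hr, integral_map (by fun_prop) (by fun_prop)]
    have e : (fun q : ℝ × ℝ => (q.1 * q.2) ^ k * g q.1) =
        fun q => (q.1 ^ k * g q.1) * q.2 ^ k := by funext q; ring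
    simp only [e]
    rw [integral_prod_mul (fun x => x ^ k * g x) fun z : ℝ => z ^ k, expMeasure,
      integral_pow_mul_gammaMeasure one_pos hr]
    simp only [pow_one, momentSeries, PowerSeries.coeff_mk, Nat.cast_zero, zero_add,
      Real.Gamma_one, one_mul]
    rw [add_comm (1 : ℝ) (k : ℝ), Real.Gamma_nat_eq_factorial]
    ring
  | succ N ih =>
    have hA := isProbabilityMeasure_flightLaw (κ := κ) hr (N + 1)
    have hfst := map_fst_flightLaw (κ := κ) hr (N + 1)
    have hbd := ae_abs_snd_le_fst_flightLaw hr hκ (N + 1)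
    -- The time after `N + 2` displacements is Gamma, so `hgi` gives the integrability of its `k`-th
    -- power times `g`. This function dominates each term of the binomial expansion.
    have hdom : Integrable
        (fun p : (ℝ × ℝ) × (ℝ × ℝ) => (p.1.1 + p.2.1) ^ k * g (p.1.1 + p.2.1))
        ((flightLaw r κ (N + 1)).prod ((expMeasure r).prod κ)) := by
      have h := (integrable_pow_mul_gammaMeasure (a := ((N + 1 : ℕ) : ℝ) + 1)
        (by positivity) hr k).2 hgi
      rw [← hfst, integrable_map_measure (by fun_prop) (by fun_prop), flightLaw,
        integrable_map_measure (by fun_prop) (by fun_prop)] at h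
      exact h
    have hF : ∀ i j, i + j = k → Integrable
        (fun p : (ℝ × ℝ) × (ℝ × ℝ) => p.1.2 ^ i * (p.2.1 * p.2.2) ^ j * g (p.1.1 + p.2.1))
        ((flightLaw r κ (N + 1)).prod ((expMeasure r).prod κ)) := by
      intro i j hij
      refine hdom.mono (by fun_prop) ?_
      have h1 := Measure.quasiMeasurePreserving_fst (μ := flightLaw r κ (N + 1))
        (ν := (expMeasure r).prod κ) |>.ae hbd
      have h2 := Measure.quasiMeasurePreserving_snd (μ := flightLaw r κ (N + 1))
        (ν := (expMeasure r).prod κ) |>.ae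
        (Measure.quasiMeasurePreserving_fst.ae (ae_pos_gammaMeasure 1 r))
      have h3 := Measure.quasiMeasurePreserving_snd (μ := flightLaw r κ (N + 1))
        (ν := (expMeasure r).prod κ) |>.ae (Measure.quasiMeasurePreserving_snd.ae hκ)
      filter_upwards [h1, h2, h3] with p h1 h2 h3
      have h0 : 0 ≤ p.1.1 := (abs_nonneg _).trans h1
      simp only [norm_mul, norm_pow, Real.norm_eq_abs]
      gcongr
      rw [abs_of_nonneg (add_nonneg h0 h2.le), ← hij, pow_add, abs_of_pos h2]
      gcongr
      · linarith
      · nlinarith [abs_nonneg p.2.2]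
    -- The factor `x ^ j` makes the new duration Gamma of shape `1 + j`, and the induction
    -- hypothesis makes the past time Gamma of shape `N + 1 + i`. Their sum has shape `N + 2 + k`
    -- whatever the splitting of `k`.
    have hterm : ∀ i j, i + j = k →
        ∫ p : (ℝ × ℝ) × (ℝ × ℝ), p.1.2 ^ i * (p.2.1 * p.2.2) ^ j * g (p.1.1 + p.2.1)
          ∂((flightLaw r κ (N + 1)).prod ((expMeasure r).prod κ)) =
        (i.factorial * (momentSeries κ ^ (N + 1)).coeff i) *
          (j.factorial * (momentSeries κ).coeff j) / r ^ k *
            ∫ u, g u ∂gammaMeasure ((N + 1 : ℕ) + 1 + k) r := by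
      intro i j hij
      have := isProbabilityMeasure_gammaMeasure (a := (N : ℝ) + 1 + i) (by positivity) hr
      have := isProbabilityMeasure_gammaMeasure (a := 1 + (j : ℝ)) (by positivity) hr
      have hconv := map_add_prod_gammaMeasure (a := 1 + (j : ℝ)) (b := (N : ℝ) + 1 + i)
        (by positivity) (by positivity) hr
      have hcast : 1 + (j : ℝ) + (N + 1 + i) = (N + 1 : ℕ) + 1 + k := by
        rw [← hij]; push_cast; ring
      rw [hcast] at hconv
      have hgi2 : Integrable (fun q : ℝ × ℝ => g (q.1 + q.2))
          ((gammaMeasure (1 + (j : ℝ)) r).prod (gammaMeasure ((N : ℝ) + 1 + i) r)) := by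
        rw [← hconv, integrable_map_measure (by fun_prop) (by fun_prop)] at hgi
        exact hgi
      rw [integral_prod_symm _ (hF i j hij)]
      have e : ∀ q : ℝ × ℝ, ∫ p : ℝ × ℝ, p.2 ^ i * (q.1 * q.2) ^ j * g (p.1 + q.1)
            ∂flightLaw r κ (N + 1) =
          (q.1 ^ j * ∫ p : ℝ × ℝ, p.2 ^ i * g (p.1 + q.1) ∂flightLaw r κ (N + 1)) * q.2 ^ j := by
        intro q
        rw [← integral_const_mul, ← integral_mul_const]
        congr 1 with p
        ring
      simp only [e]
      rw [integral_prod_mul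
          (fun x => x ^ j * ∫ p : ℝ × ℝ, p.2 ^ i * g (p.1 + x) ∂flightLaw r κ (N + 1))
          fun z : ℝ => z ^ j, expMeasure, integral_pow_mul_gammaMeasure one_pos hr]
      have e2 : ∀ᵐ x ∂gammaMeasure (1 + (j : ℝ)) r,
          ∫ p : ℝ × ℝ, p.2 ^ i * g (p.1 + x) ∂flightLaw r κ (N + 1) =
          i.factorial * (momentSeries κ ^ (N + 1)).coeff i / r ^ i *
            ∫ u, g (x + u) ∂gammaMeasure (N + 1 + i) r := by
        filter_upwards [hgi2.prod_right_ae] with x hx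
        simp only [add_comm x] at hx ⊢
        exact ih i (g := fun u => g (u + x)) (by fun_prop) hx
      rw [integral_congr_ae e2, integral_const_mul, ← integral_prod _ hgi2, ← hconv,
        integral_map (by fun_prop) (by fun_prop), add_comm (1 : ℝ) (j : ℝ),
        Real.Gamma_nat_eq_factorial, Real.Gamma_one, ← hij, pow_add]
      simp only [momentSeries, PowerSeries.coeff_mk]
      ring
    rw [flightLaw, integral_map (by fun_prop) (by fun_prop)]
    have e : ∀ p : (ℝ × ℝ) × (ℝ × ℝ), (flightStep p).2 ^ k * g (flightStep p).1 =
        ∑ m ∈ Finset.HasAntidiagonal.antidiagonal k, (k.choose m.1 : ℝ) *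
          (p.1.2 ^ m.1 * (p.2.1 * p.2.2) ^ m.2 * g (p.1.1 + p.2.1)) := by
      intro p
      simp only [flightStep]
      rw [(Commute.all _ _).add_pow', Finset.sum_mul]
      refine Finset.sum_congr rfl fun m _ => ?_
      rw [nsmul_eq_mul]
      ring
    simp only [e]
    rw [integral_finsetSum _ fun m hm =>
      (hF m.1 m.2 (Finset.HasAntidiagonal.mem_antidiagonal.1 hm)).const_mul _, pow_succ _ (N + 1),
      PowerSeries.coeff_mul, Finset.mul_sum, Finset.sum_div, Finset.sum_mul]
    refine Finset.sum_congr rfl fun m hm => ?_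
    have hm' := Finset.HasAntidiagonal.mem_antidiagonal.1 hm
    rw [integral_const_mul, hterm _ _ hm']
    -- The binomial coefficient times `i! j!` is `k!`, so what remains is the Cauchy product for the
    -- next power of the moment series.
    have hch := Nat.choose_mul_factorial_mul_factorial (n := k) (k := m.1) (by omega)
    have hk2 : k - m.1 = m.2 := by omega
    rw [hk2] at hch
    rw [← hch]
    push_cast
    ring

end

/-! ### Powers of the moment series of the cosine -/

theorem integral_cos_pow_add_two (k : ℕ) : ∫ x in (0 : ℝ)..Real.pi, Real.cos x ^ (k + 2) =
    (k + 1) / (k + 2) * ∫ x in (0 : ℝ)..Real.pi, Real.cos x ^ k := by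
  rw [integral_cos_pow]; simp

theorem integral_cos_pow_odd (k : ℕ) : ∫ x in (0 : ℝ)..Real.pi, Real.cos x ^ (2 * k + 1) = 0 := by
  induction k with
  | zero => simp
  | succ k ih => rw [show 2 * (k + 1) + 1 = 2 * k + 1 + 2 by ring, integral_cos_pow_add_two, ih]; simp

theorem integral_cos_pow_two_mul (k : ℕ) :
    ∫ x in (0 : ℝ)..Real.pi, Real.cos x ^ (2 * k) = Real.pi * (k.centralBinom / 4 ^ k) := by
  induction k with
  | zero => simp
  | succ k ih =>
    rw [show 2 * (k + 1) = 2 * k + 2 by ring, integral_cos_pow_add_two, ih]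
    have h : ((k : ℝ) + 1) * (k + 1).centralBinom = 2 * (2 * k + 1) * k.centralBinom := by
      exact_mod_cast Nat.succ_mul_centralBinom_succ k
    push_cast
    have h2 : ((k + 1).centralBinom : ℝ) = 2 * (2 * k + 1) * k.centralBinom / (k + 1) := by
      field_simp; linarith
    rw [h2]
    field_simp
    ring

theorem integral_angleLaw (m : ℕ) (f : ℝ → ℝ) : ∫ θ, f θ ∂angleLaw (m : ℝ) =
    Real.Gamma (m + 1) / (Real.sqrt Real.pi * Real.Gamma (m + 1 / 2)) *
      ∫ θ in (0 : ℝ)..Real.pi, Real.sin θ ^ (2 * m) * f θ := by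
  have hC : 0 ≤ Real.Gamma (m + 1) / (Real.sqrt Real.pi * Real.Gamma (m + 1 / 2)) := by
    have := Real.Gamma_pos_of_pos (s := (m : ℝ) + 1) (by positivity)
    have := Real.Gamma_pos_of_pos (s := (m : ℝ) + 1 / 2) (by positivity)
    positivity
  rw [angleLaw, integral_withDensity_eq_integral_toReal_smul (by fun_prop) (by simp),
    ← intervalIntegral.integral_const_mul, intervalIntegral.integral_of_le Real.pi_pos.le,
    integral_Ioc_eq_integral_Ioo]
  refine setIntegral_congr_fun measurableSet_Ioo fun θ hθ => ?_
  have hs := Real.sin_pos_of_mem_Ioo hθ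
  have e : Real.sin θ ^ (2 * (m : ℝ)) = Real.sin θ ^ (2 * m) := by
    rw [← Real.rpow_natCast]; push_cast; rfl
  simp only [smul_eq_mul]
  rw [ENNReal.toReal_ofReal (by positivity), e]
  ring

theorem integral_cos_pow_angleLaw_zero (k : ℕ) :
    ∫ θ, Real.cos θ ^ k ∂angleLaw ((0 : ℕ) : ℝ) =
      (∫ θ in (0 : ℝ)..Real.pi, Real.cos θ ^ k) / Real.pi := by
  rw [integral_angleLaw]
  simp only [Nat.cast_zero, zero_add, Real.Gamma_one, Real.Gamma_one_half_eq, mul_zero, pow_zero,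
    one_mul, Real.mul_self_sqrt Real.pi_pos.le]
  ring

theorem integral_cos_pow_angleLaw_one (k : ℕ) :
    ∫ θ, Real.cos θ ^ k ∂angleLaw ((1 : ℕ) : ℝ) =
      2 / (k + 2) * (∫ θ in (0 : ℝ)..Real.pi, Real.cos θ ^ k) / Real.pi := by
  rw [integral_angleLaw]
  -- By the Wallis recurrence the difference of the two cosine integrals is `1 / (k + 2)` times the
  -- first one; the normalising constant is `2 / π`.
  have e : ∀ θ, Real.sin θ ^ (2 * 1) * Real.cos θ ^ k = Real.cos θ ^ k - Real.cos θ ^ (k + 2) := by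
    intro θ
    rw [mul_one, Real.sin_sq]; ring
  simp only [e]
  rw [intervalIntegral.integral_sub (Continuous.intervalIntegrable (by fun_prop) _ _)
    (Continuous.intervalIntegrable (by fun_prop) _ _), integral_cos_pow_add_two]
  have h2 : Real.Gamma (((1 : ℕ) : ℝ) + 1) = 1 := by
    rw [Real.Gamma_nat_eq_factorial]; simp
  have h3 : Real.Gamma (((1 : ℕ) : ℝ) + 1 / 2) = 1 / 2 * Real.sqrt Real.pi := by
    rw [add_comm, Nat.cast_one, Real.Gamma_add_one (by norm_num), Real.Gamma_one_half_eq]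
  have hk : (k : ℝ) + 2 ≠ 0 := by positivity
  have hs : Real.sqrt Real.pi * (1 / 2 * Real.sqrt Real.pi) = Real.pi / 2 := by
    rw [mul_left_comm, Real.mul_self_sqrt Real.pi_pos.le]; ring
  rw [h2, h3, hs]
  have := Real.pi_pos
  field_simp
  ring

/-- Coefficients of the powers of `F` when `(1 - X) F' = F / 2`. -/
theorem coeff_pow_succ_of_centralBinom {F : PowerSeries ℝ}
    (hF : ∀ k, F.coeff k = (k.centralBinom : ℝ) / 4 ^ k) (N k : ℕ) :
    ((k : ℝ) + 1) * (F ^ N).coeff (k + 1) = (N / 2 + k) * (F ^ N).coeff k := by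
  -- The series is `(1 - X)^(-1/2)`, and the central binomial recurrence is this differential
  -- equation read on coefficients.
  have hode : (1 - PowerSeries.X) * PowerSeries.derivative ℝ F = PowerSeries.C (1 / 2 : ℝ) * F := by
    ext k
    have h : ((k : ℝ) + 1) * (k + 1).centralBinom = 2 * (2 * k + 1) * k.centralBinom := by
      exact_mod_cast Nat.succ_mul_centralBinom_succ k
    have h4 : ((k : ℝ) + 1) * ((k + 1).centralBinom / 4 ^ (k + 1)) =
        (k + 1 / 2) * (k.centralBinom / 4 ^ k) := by
      rw [pow_succ, ← mul_div_assoc, h]; field_simp; ring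
    rw [sub_mul, one_mul, map_sub, PowerSeries.coeff_C_mul, hF]
    cases k with
    | zero =>
      rw [PowerSeries.coeff_zero_X_mul, PowerSeries.coeff_derivative, hF]
      push_cast at h4 ⊢
      linarith
    | succ k =>
      rw [PowerSeries.coeff_succ_X_mul, PowerSeries.coeff_derivative,
        PowerSeries.coeff_derivative, hF, hF]
      push_cast at h4 ⊢
      linarith
  -- The logarithmic derivative of a power is a multiple of that of `F`, so only the constant
  -- changes.
  have hpow : (1 - PowerSeries.X) * PowerSeries.derivative ℝ (F ^ N) =
      PowerSeries.C (N / 2 : ℝ) * F ^ N := by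
    cases N with
    | zero => simp
    | succ N =>
      rw [PowerSeries.derivative_pow, Nat.add_sub_cancel]
      have hc : PowerSeries.C (((N + 1 : ℕ) : ℝ) / 2) =
          ((N + 1 : ℕ) : PowerSeries ℝ) * PowerSeries.C (1 / 2 : ℝ) := by
        rw [← map_natCast (PowerSeries.C (R := ℝ)), ← map_mul]; congr 1; ring
      rw [hc, pow_succ]
      linear_combination ((N + 1 : ℕ) : PowerSeries ℝ) * F ^ N * hode
  have := congrArg (PowerSeries.coeff k) hpow
  rw [sub_mul, one_mul, map_sub, PowerSeries.coeff_C_mul] at this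
  cases k with
  | zero =>
    rw [PowerSeries.coeff_zero_X_mul, PowerSeries.coeff_derivative] at this
    push_cast at this ⊢
    linarith
  | succ k =>
    rw [PowerSeries.coeff_succ_X_mul, PowerSeries.coeff_derivative,
      PowerSeries.coeff_derivative] at this
    push_cast at this ⊢
    linarith

theorem two_mul_self_mul_catalan (k : ℕ) :
    (catalan k : ℝ) * k.factorial * (k + 1).factorial = (2 * k).factorial := by
  have h1 : ((k : ℝ) + 1) * catalan k = k.centralBinom := by
    exact_mod_cast succ_mul_catalan_eq_centralBinom k
  have h2 : (k.centralBinom : ℝ) * k.factorial * k.factorial = (2 * k).factorial := by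
    have := Nat.choose_mul_factorial_mul_factorial (n := 2 * k) (k := k) (by omega)
    rw [show 2 * k - k = k by omega, ← Nat.centralBinom_eq_two_mul_choose] at this
    exact_mod_cast this
  rw [← h2, ← h1, Nat.factorial_succ]
  push_cast
  ring

/-- Coefficients of the powers of the rescaled Catalan series. -/
theorem coeff_pow_of_catalan {F : PowerSeries ℝ}
    (hF : ∀ k, F.coeff k = (catalan k : ℝ) / 4 ^ k) (M k : ℕ) :
    (F ^ (M + 1)).coeff k * (4 ^ k * k.factorial * (k + M + 1).factorial) =
      (M + 1) * (2 * k + M).factorial := by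
  have hsq : ∀ k, (F ^ 2).coeff k = 4 * F.coeff (k + 1) := by
    intro k
    rw [sq, PowerSeries.coeff_mul, hF, catalan_succ', Nat.cast_sum, Finset.sum_div,
      Finset.mul_sum]
    refine Finset.sum_congr rfl fun p hp => ?_
    have := Finset.HasAntidiagonal.mem_antidiagonal.1 hp
    rw [hF, hF, pow_succ, ← this, pow_add]
    push_cast
    field_simp
  -- The functional equation of the Catalan generating function, at `X / 4`. Multiplied by `F ^ N`,
  -- it links three consecutive powers, whence the two-step induction on the exponent.
  have hfun : F = 1 + PowerSeries.C (1 / 4 : ℝ) * (PowerSeries.X * F ^ 2) := by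
    ext k
    cases k with
    | zero =>
      rw [map_add, PowerSeries.coeff_C_mul, PowerSeries.coeff_zero_X_mul, hF]
      simp
    | succ k =>
      rw [map_add, PowerSeries.coeff_C_mul, PowerSeries.coeff_succ_X_mul, hsq,
        PowerSeries.coeff_one]
      simp
  have hrec : ∀ N k, (F ^ (N + 2)).coeff k =
      4 * ((F ^ (N + 1)).coeff (k + 1) - (F ^ N).coeff (k + 1)) := by
    intro N k
    have : F ^ (N + 1) = F ^ N + PowerSeries.C (1 / 4 : ℝ) * (PowerSeries.X * F ^ (N + 2)) := by
      linear_combination F ^ N * hfun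
    rw [this, map_add, PowerSeries.coeff_C_mul, PowerSeries.coeff_succ_X_mul]
    ring
  have hone : ∀ k, F.coeff k * (4 ^ k * k.factorial * (k + 1).factorial) =
      (2 * k).factorial := by
    intro k
    rw [hF, ← two_mul_self_mul_catalan]
    field_simp
  induction M using Nat.twoStepInduction generalizing k with
  | zero => simpa using hone k
  | one =>
    rw [show 1 + 1 = 2 from rfl, hsq]
    have := hone (k + 1)
    rw [show 2 * (k + 1) = 2 * k + 1 + 1 by ring, Nat.factorial_succ (2 * k + 1),
      Nat.factorial_succ k, pow_succ (4 : ℝ) k] at this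
    push_cast at this ⊢
    have hk : (k : ℝ) + 1 ≠ 0 := by positivity
    refine mul_left_cancel₀ hk ?_
    linear_combination this
  | more M ih0 ih1 =>
    have h0 := ih0 (k + 1)
    have h1 := ih1 (k + 1)
    rw [show k + 1 + M + 1 = k + M + 2 by ring, show 2 * (k + 1) + M = 2 * k + M + 2 by ring,
      Nat.factorial_succ k, pow_succ (4 : ℝ) k] at h0
    rw [show k + 1 + (M + 1) + 1 = k + M + 2 + 1 by ring,
      show 2 * (k + 1) + (M + 1) = 2 * k + M + 2 + 1 by ring,
      Nat.factorial_succ k, Nat.factorial_succ (k + M + 2), Nat.factorial_succ (2 * k + M + 2),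
      pow_succ (4 : ℝ) k] at h1
    rw [show M + 2 + 1 = (M + 1) + 2 by ring, hrec, show k + (M + 2) + 1 = k + M + 2 + 1 by ring,
      show 2 * k + (M + 2) = 2 * k + M + 2 by ring, Nat.factorial_succ (k + M + 2)]
    push_cast at h0 h1 ⊢
    have hk : (k : ℝ) + 1 ≠ 0 := by positivity
    refine mul_left_cancel₀ hk ?_
    linear_combination h1 - (k + M + 3) * h0

theorem coeff_pow_succ_of_catalan {F : PowerSeries ℝ}
    (hF : ∀ k, F.coeff k = (catalan k : ℝ) / 4 ^ k) (M k : ℕ) :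
    (F ^ (M + 1)).coeff (k + 1) * (4 * (k + 1) * (k + M + 2)) =
      (F ^ (M + 1)).coeff k * ((2 * k + M + 1) * (2 * k + M + 2)) := by
  have h0 := coeff_pow_of_catalan hF M k
  have h1 := coeff_pow_of_catalan hF M (k + 1)
  rw [show k + 1 + M + 1 = k + M + 1 + 1 by ring,
    show 2 * (k + 1) + M = 2 * k + M + 1 + 1 by ring, Nat.factorial_succ k,
    Nat.factorial_succ (k + M + 1), Nat.factorial_succ (2 * k + M + 1),
    Nat.factorial_succ (2 * k + M), pow_succ (4 : ℝ) k] at h1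
  have hp : (4 : ℝ) ^ k * k.factorial * (k + M + 1).factorial ≠ 0 := by positivity
  refine mul_left_cancel₀ hp ?_
  push_cast at h1
  linear_combination h1 - (2 * k + M + 1) * (2 * k + M + 2) * h0

noncomputable section

/-- The law of the cosine of the random angle. -/
def cosLaw (ν : ℝ) : Measure ℝ := (angleLaw ν).map Real.cos

end

theorem momentSeries_cosLaw_coeff (ν : ℝ) (k : ℕ) :
    (momentSeries (cosLaw ν)).coeff k = ∫ θ, Real.cos θ ^ k ∂angleLaw ν := by
  rw [momentSeries, PowerSeries.coeff_mk, cosLaw,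
    integral_map Real.measurable_cos.aemeasurable (by fun_prop)]

/-- The even part of the moment series of the cosine of the angle. -/
theorem momentSeries_cosLaw_eq_expand {m : ℕ} (hm : m = 0 ∨ m = 1) :
    momentSeries (cosLaw (m : ℝ)) = PowerSeries.expand 2 two_ne_zero
      (PowerSeries.mk fun k => ∫ θ, Real.cos θ ^ (2 * k) ∂angleLaw (m : ℝ)) := by
  ext k
  rw [momentSeries_cosLaw_coeff, PowerSeries.coeff_expand]
  split_ifs with hk
  · rw [PowerSeries.coeff_mk, Nat.mul_div_cancel' hk]
  · obtain ⟨j, rfl⟩ : ∃ j, k = 2 * j + 1 := ⟨k / 2, by omega⟩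
    rcases hm with rfl | rfl
    · rw [integral_cos_pow_angleLaw_zero, integral_cos_pow_odd, zero_div]
    · rw [integral_cos_pow_angleLaw_one, integral_cos_pow_odd, mul_zero, zero_div]

theorem coeff_odd_momentSeries_pow {m : ℕ} (hm : m = 0 ∨ m = 1) (N k : ℕ) :
    (momentSeries (cosLaw (m : ℝ)) ^ N).coeff (2 * k + 1) = 0 := by
  rw [momentSeries_cosLaw_eq_expand hm, ← map_pow]
  exact PowerSeries.coeff_expand_of_not_dvd _ _ _ (by omega)

/-- Both angle laws are brought to one shape, with `motionIndex` as the only trace of `m`. For `m =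
0` both sides of the recurrence are multiplied by `n + 2k + 2`. The factors `(n + 2k + 1)(n + 2k +
2)` will cancel against `n! / (n + k)!` in the moments of the flight. -/
theorem coeff_even_momentSeries_pow_succ (m : Fin 2) (n k : ℕ) :
    (momentSeries (cosLaw ((m : ℕ) : ℝ)) ^ (n + 1)).coeff (2 * (k + 1)) *
        ((2 * k + 2) * (motionIndex m n + 1 + k)) =
      (momentSeries (cosLaw ((m : ℕ) : ℝ)) ^ (n + 1)).coeff (2 * k) *
        (1 / 2 * ((n + 2 * k + 1) * (n + 2 * k + 2))) := by
  have hm : (m : ℕ) = 0 ∨ (m : ℕ) = 1 := by omega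
  rw [momentSeries_cosLaw_eq_expand hm, ← map_pow, PowerSeries.coeff_expand_mul,
    PowerSeries.coeff_expand_mul]
  rcases hm with h | h
  · obtain rfl : m = 0 := Fin.ext h
    have := coeff_pow_succ_of_centralBinom (F := PowerSeries.mk fun k =>
      ∫ θ, Real.cos θ ^ (2 * k) ∂angleLaw ((0 : ℕ) : ℝ)) (fun k => by
        rw [PowerSeries.coeff_mk, integral_cos_pow_angleLaw_zero, integral_cos_pow_two_mul]
        have := Real.pi_pos
        field_simp) (n + 1) k
    push_cast at this
    simp only [motionIndex, if_true, Fin.val_zero, Nat.cast_zero]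
    linear_combination (n + 2 * k + 2) * this
  · obtain rfl : m = 1 := Fin.ext h
    have := coeff_pow_succ_of_catalan (F := PowerSeries.mk fun k =>
      ∫ θ, Real.cos θ ^ (2 * k) ∂angleLaw ((1 : ℕ) : ℝ)) (fun k => by
        rw [PowerSeries.coeff_mk, integral_cos_pow_angleLaw_one, integral_cos_pow_two_mul]
        have h1 : ((k : ℝ) + 1) * catalan k = k.centralBinom := by
          exact_mod_cast succ_mul_catalan_eq_centralBinom k
        have := Real.pi_pos
        rw [← h1]
        push_cast
        field_simp) n k
    simp only [motionIndex, Fin.val_one, one_ne_zero, if_false]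
    linear_combination this / 2

/-! ### Moments of the Gaussian mixture -/

theorem integral_pow_odd_gaussianReal (k : ℕ) : ∫ x, x ^ (2 * k + 1) ∂gaussianReal 0 1 = 0 := by
  have h : ∫ x, x ^ (2 * k + 1) ∂gaussianReal 0 1 = -∫ x, x ^ (2 * k + 1) ∂gaussianReal 0 1 := by
    conv_lhs => rw [← neg_zero, ← gaussianReal_map_neg (μ := 0) (v := 1),
      integral_map (by fun_prop) (by fun_prop)]
    rw [← integral_neg]
    congr 1 with x
    exact (Odd.neg_pow ⟨k, rfl⟩ x)
  linarith

theorem integral_pow_even_gaussianReal (k : ℕ) : ∫ x, x ^ (2 * k) ∂gaussianReal 0 1 =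
    2 * (√(2 * Real.pi))⁻¹ * ((1 / 2 : ℝ) ^ (-((k : ℝ) + 1 / 2)) * (1 / 2) *
      Real.Gamma (k + 1 / 2)) := by
  rw [integral_gaussianReal_eq_integral_smul one_ne_zero]
  have h := integral_rpow_mul_exp_neg_mul_rpow (p := 2) (q := 2 * (k : ℝ)) (b := 1 / 2)
    (by norm_num) (by have : (0 : ℝ) ≤ k := by positivity
                      linarith) (by norm_num)
  rw [show (2 * (k : ℝ) + 1) / 2 = k + 1 / 2 by ring,
    show -(2 * (k : ℝ) + 1) / 2 = -((k : ℝ) + 1 / 2) by ring] at h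
  rw [← h, mul_assoc, ← integral_const_mul, ← integral_comp_abs
    (f := fun x => (√(2 * Real.pi))⁻¹ * (x ^ (2 * (k : ℝ)) * Real.exp (-(1 / 2) * x ^ (2 : ℝ))))]
  refine integral_congr_ae (.of_forall fun x => ?_)
  have e1 : |x| ^ (2 * (k : ℝ)) = x ^ (2 * k) := by
    rw [← Even.pow_abs ⟨k, by ring⟩ x, ← Real.rpow_natCast]; push_cast; rfl
  have e2 : |x| ^ (2 : ℝ) = x ^ 2 := by rw [← sq_abs x, ← Real.rpow_natCast]; norm_num
  simp only [e1, e2, gaussianPDFReal, smul_eq_mul, sub_zero, NNReal.coe_one, mul_one]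
  rw [show -(1 / 2) * x ^ 2 = -x ^ 2 / 2 by ring]
  ring

theorem integral_pow_even_succ_gaussianReal (k : ℕ) : ∫ x, x ^ (2 * (k + 1)) ∂gaussianReal 0 1 =
    (2 * k + 1) * ∫ x, x ^ (2 * k) ∂gaussianReal 0 1 := by
  rw [integral_pow_even_gaussianReal, integral_pow_even_gaussianReal]
  have h1 : Real.Gamma (((k + 1 : ℕ) : ℝ) + 1 / 2) = (k + 1 / 2) * Real.Gamma (k + 1 / 2) := by
    rw [← Real.Gamma_add_one (by positivity)]; push_cast; ring_nf
  have h2 : (1 / 2 : ℝ) ^ (-(((k + 1 : ℕ) : ℝ) + 1 / 2)) =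
      2 * (1 / 2 : ℝ) ^ (-((k : ℝ) + 1 / 2)) := by
    rw [show -(((k + 1 : ℕ) : ℝ) + 1 / 2) = -((k : ℝ) + 1 / 2) + (-1) by push_cast; ring,
      Real.rpow_add (by norm_num), Real.rpow_neg_one]
    ring
  rw [h1, h2]
  ring

theorem integral_pow_succ_gammaMeasure {a r : ℝ} (ha : 0 < a) (hr : 0 < r) (k : ℕ) :
    ∫ x, x ^ (k + 1) ∂gammaMeasure a r = (a + k) / r * ∫ x, x ^ k ∂gammaMeasure a r := by
  rw [integral_pow_gammaMeasure ha hr, integral_pow_gammaMeasure ha hr]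
  push_cast
  rw [← add_assoc, Real.Gamma_add_one (by positivity), pow_succ]
  have := (Real.Gamma_pos_of_pos ha).ne'
  field_simp

theorem integral_pow_succ_betaMeasure {a b : ℝ} (ha : 0 < a) (hb : 0 < b) (k : ℕ) :
    ∫ x, x ^ (k + 1) ∂betaMeasure a b = (a + k) / (a + b + k) * ∫ x, x ^ k ∂betaMeasure a b := by
  rw [integral_pow_betaMeasure ha hb, integral_pow_betaMeasure ha hb]
  simp only [beta]
  push_cast
  rw [show a + ((k : ℝ) + 1) + b = (a + b + k) + 1 by ring, ← add_assoc,
    show a + (k : ℝ) + b = a + b + k by ring, Real.Gamma_add_one (by positivity),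
    Real.Gamma_add_one (by positivity)]
  have := (Real.Gamma_pos_of_pos ha).ne'
  have := (Real.Gamma_pos_of_pos hb).ne'
  have := (Real.Gamma_pos_of_pos (add_pos ha hb)).ne'
  have := (Real.Gamma_pos_of_pos (show 0 < a + b + k by positivity)).ne'
  have : a + b + k ≠ 0 := by positivity
  field_simp

noncomputable section

/-- The centred Gaussian law with random variance `σ * Z * W`, `Z` Gamma and `W` Beta. -/
def gaussianMixture (σ a₁ a b : ℝ) : Measure ℝ :=
  (((gammaMeasure a₁ 1).prod (betaMeasure a b)).prod (gaussianReal 0 1)).map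
    fun p => √(σ * (p.1.1 * p.1.2)) * p.2

end

section

variable {σ a₁ a b : ℝ}

theorem isProbabilityMeasure_gaussianMixture (ha₁ : 0 < a₁) (ha : 0 < a) (hb : 0 < b) :
    IsProbabilityMeasure (gaussianMixture σ a₁ a b) := by
  have := isProbabilityMeasure_gammaMeasure ha₁ one_pos
  have := isProbabilityMeasureBeta ha hb
  exact Measure.isProbabilityMeasure_map (by fun_prop)

theorem gaussianMixture_apply (ha₁ : 0 < a₁) (ha : 0 < a) (hb : 0 < b) {A : Set ℝ}
    (hA : MeasurableSet A) : gaussianMixture σ a₁ a b A =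
      ∫⁻ z, ∫⁻ w, gaussianReal 0 (Real.toNNReal (σ * (z * w))) A
        ∂(betaMeasure a b) ∂(gammaMeasure a₁ 1) := by
  have := isProbabilityMeasure_gammaMeasure ha₁ one_pos
  have := isProbabilityMeasureBeta ha hb
  have hm : Measurable fun p : (ℝ × ℝ) × ℝ => √(σ * (p.1.1 * p.1.2)) * p.2 := by fun_prop
  have h : ∀ q : ℝ × ℝ, gaussianReal 0 1 (Prod.mk q ⁻¹'
      ((fun p : (ℝ × ℝ) × ℝ => √(σ * (p.1.1 * p.1.2)) * p.2) ⁻¹' A)) =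
      gaussianReal 0 (Real.toNNReal (σ * (q.1 * q.2))) A := by
    intro q
    have := gaussianReal_map_const_mul (μ := 0) (v := 1) √(σ * (q.1 * q.2))
    rw [mul_zero, mul_one] at this
    -- For a negative product both `√` and `Real.toNNReal` return `0`, so no sign condition on `q`
    -- is needed.
    have e : NNReal.mk (√(σ * (q.1 * q.2)) ^ 2) (sq_nonneg _) = Real.toNNReal (σ * (q.1 * q.2)) := by
      ext
      simp only [NNReal.coe_mk, Real.coe_toNNReal']
      rcases le_total 0 (σ * (q.1 * q.2)) with h0 | h0
      · rw [Real.sq_sqrt h0, max_eq_left h0]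
      · rw [Real.sqrt_eq_zero_of_nonpos h0, max_eq_right h0]; simp
    rw [e] at this
    rw [← this, Measure.map_apply (by fun_prop) hA]
    rfl
  rw [gaussianMixture, Measure.map_apply hm hA, Measure.prod_apply (hm hA), lintegral_prod]
  · simp only [h]
  · exact (measurable_measure_prodMk_left (hm hA)).aemeasurable

theorem integral_pow_gaussianMixture (k : ℕ) (ha₁ : 0 < a₁) (ha : 0 < a) (hb : 0 < b) :
    ∫ x, x ^ k ∂gaussianMixture σ a₁ a b =
      (∫ q : ℝ × ℝ, √(σ * (q.1 * q.2)) ^ k ∂(gammaMeasure a₁ 1).prod (betaMeasure a b)) *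
        ∫ x, x ^ k ∂gaussianReal 0 1 := by
  have := isProbabilityMeasure_gammaMeasure ha₁ one_pos
  have := isProbabilityMeasureBeta ha hb
  rw [gaussianMixture, integral_map (by fun_prop) (by fun_prop), ← integral_prod_mul]
  simp only [mul_pow]

theorem integral_pow_odd_gaussianMixture (k : ℕ) (ha₁ : 0 < a₁) (ha : 0 < a) (hb : 0 < b) :
    ∫ x, x ^ (2 * k + 1) ∂gaussianMixture σ a₁ a b = 0 := by
  rw [integral_pow_gaussianMixture _ ha₁ ha hb, integral_pow_odd_gaussianReal, mul_zero]

theorem integral_pow_even_gaussianMixture (k : ℕ) (hσ : 0 ≤ σ) (ha₁ : 0 < a₁) (ha : 0 < a)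
    (hb : 0 < b) : ∫ x, x ^ (2 * k) ∂gaussianMixture σ a₁ a b =
      σ ^ k * (∫ z, z ^ k ∂gammaMeasure a₁ 1) * (∫ w, w ^ k ∂betaMeasure a b) *
        ∫ x, x ^ (2 * k) ∂gaussianReal 0 1 := by
  have := isProbabilityMeasure_gammaMeasure ha₁ one_pos
  have := isProbabilityMeasureBeta ha hb
  rw [integral_pow_gaussianMixture _ ha₁ ha hb, mul_assoc (σ ^ k),
    ← integral_prod_mul (fun z : ℝ => z ^ k) fun w : ℝ => w ^ k, ← integral_const_mul (σ ^ k)]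
  congr 1
  refine integral_congr_ae ?_
  filter_upwards [Measure.quasiMeasurePreserving_fst.ae (ae_pos_gammaMeasure a₁ 1),
    Measure.quasiMeasurePreserving_snd.ae (ae_mem_Ioo_betaMeasure a b)] with q h1 h2
  have := h2.1
  rw [pow_mul, Real.sq_sqrt (by positivity)]
  ring

/-- By independence the even moments are products of Gamma, Beta and Gaussian moments, each with an
explicit ratio of consecutive terms. -/
theorem integral_pow_even_succ_gaussianMixture (k : ℕ) (hσ : 0 ≤ σ) (ha₁ : 0 < a₁) (ha : 0 < a)
    (hb : 0 < b) : ∫ x, x ^ (2 * (k + 1)) ∂gaussianMixture σ a₁ a b =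
      σ * (a₁ + k) * (a + k) / (a + b + k) * (2 * k + 1) *
        ∫ x, x ^ (2 * k) ∂gaussianMixture σ a₁ a b := by
  rw [integral_pow_even_gaussianMixture _ hσ ha₁ ha hb,
    integral_pow_even_gaussianMixture _ hσ ha₁ ha hb, integral_pow_even_succ_gaussianReal,
    integral_pow_succ_betaMeasure ha hb, integral_pow_succ_gammaMeasure ha₁ one_pos]
  ring

/-- Given the variance, the generating function at `u` is `exp (σ z w u² / 2)`. Since `w < 1`, it is
at most `exp (σ u² z / 2)`, which is integrable for the Gamma law of rate one as soon as `σ u² / 2 <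
1`. -/
theorem zero_mem_interior_integrableExpSet_gaussianMixture (hσ : 0 < σ) (ha₁ : 0 < a₁)
    (ha : 0 < a) (hb : 0 < b) :
    0 ∈ interior (integrableExpSet id (gaussianMixture σ a₁ a b)) := by
  have := isProbabilityMeasure_gammaMeasure ha₁ one_pos
  have := isProbabilityMeasureBeta ha hb
  rw [mem_interior_iff_mem_nhds]
  have hnear : ∀ᶠ u : ℝ in nhds 0, σ * u ^ 2 / 2 < 1 := by
    have hc : Filter.Tendsto (fun u : ℝ => σ * u ^ 2 / 2) (nhds 0) (nhds (σ * 0 ^ 2 / 2)) :=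
      (by fun_prop : Continuous fun u : ℝ => σ * u ^ 2 / 2).tendsto 0
    exact hc.eventually (gt_mem_nhds (by norm_num))
  filter_upwards [hnear] with u hu
  simp only [integrableExpSet, mem_ofPred_eq, id]
  rw [gaussianMixture, integrable_map_measure (by fun_prop) (by fun_prop),
    integrable_prod_iff (by fun_prop)]
  have hint : ∀ s : ℝ, Integrable (fun x => Real.exp (s * x)) (gaussianReal 0 1) :=
    fun s => integrable_exp_mul_gaussianReal s
  have hmgf : ∀ s : ℝ, ∫ x, Real.exp (s * x) ∂gaussianReal 0 1 = Real.exp (s ^ 2 / 2) := by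
    intro s
    have := congrFun (mgf_fun_id_gaussianReal (μ := 0) (v := 1)) s
    simpa [mgf] using this
  simp only [Function.comp_apply, Real.norm_eq_abs, Real.abs_exp, ← mul_assoc]
  refine ⟨.of_forall fun q => hint _, ?_⟩
  simp only [hmgf]
  have hdom : Integrable (fun q : ℝ × ℝ => Real.exp (σ * u ^ 2 / 2 * q.1) * 1)
      ((gammaMeasure a₁ 1).prod (betaMeasure a b)) :=
    (integrable_exp_mul_gammaMeasure ha₁ one_pos hu).mul_prod (integrable_const 1)
  refine hdom.mono (by fun_prop) ?_
  filter_upwards [Measure.quasiMeasurePreserving_fst.ae (ae_pos_gammaMeasure a₁ 1),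
    Measure.quasiMeasurePreserving_snd.ae (ae_mem_Ioo_betaMeasure a b)] with q h1 h2
  have h20 := h2.1
  have h21 := h2.2
  rw [mul_one, Real.norm_eq_abs, Real.norm_eq_abs, Real.abs_exp, Real.abs_exp, Real.exp_le_exp,
    mul_pow, Real.sq_sqrt (by positivity)]
  have : 0 ≤ σ * u ^ 2 / 2 * q.1 := by positivity
  nlinarith
end

/-! ### The Macdonald function and the density of the mixture -/

theorem lintegral_eq_lintegral_Ioi_add_comp_neg {f : ℝ → ℝ≥0∞} (hf : Measurable f) :
    ∫⁻ u, f u = ∫⁻ u in Ioi (0 : ℝ), (f u + f (-u)) := by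
  rw [lintegral_add_left hf, ← lintegral_add_compl f (measurableSet_Ioi (a := (0 : ℝ)))]
  congr 1
  have h := (Measure.measurePreserving_neg (volume : Measure ℝ)).setLIntegral_comp_preimage
    (measurableSet_Iio (a := (0 : ℝ))) hf
  rw [compl_Ioi, ← restrict_Iio_eq_restrict_Iic, ← h]
  congr 2
  ext u
  simp

theorem image_mul_exp_univ {b : ℝ} (hb : 0 < b) : (fun u => b * Real.exp u) '' univ = Ioi 0 := by
  ext z
  simp only [image_univ, mem_range, mem_Ioi]
  constructor
  · rintro ⟨u, rfl⟩
    positivity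
  · intro hz
    refine ⟨Real.log (z / b), ?_⟩
    rw [Real.exp_log (by positivity)]
    field_simp

/-- The integral representation of the Macdonald function on the half-line. -/
theorem lintegral_rpow_mul_exp_eq_macdonaldK {μ y : ℝ} (hμ : 0 < μ) (hy : 0 < y) :
    ∫⁻ z in Ioi (0 : ℝ), ENNReal.ofReal (z ^ (μ - 1) * Real.exp (-z - y ^ 2 / (4 * z))) =
      ENNReal.ofReal (2 * (y / 2) ^ μ * macdonaldK (-μ) y) := by
  have hy2 : 0 < y / 2 := by positivity
  -- The substitution `z = (y / 2) e^u` makes the exponent `-y cosh u`; folding the line at `u = 0`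
  -- turns `e^(μu)` into `2 cosh (μu)`.
  have hcv : ∫⁻ z in Ioi (0 : ℝ), ENNReal.ofReal (z ^ (μ - 1) * Real.exp (-z - y ^ 2 / (4 * z))) =
      ∫⁻ u in Ioi (0 : ℝ), ENNReal.ofReal (2 * (y / 2) ^ μ *
        (Real.exp (-y * Real.cosh u) * Real.cosh (-μ * u))) := by
    conv_lhs => rw [← image_mul_exp_univ hy2]
    rw [lintegral_image_eq_lintegral_abs_deriv_mul MeasurableSet.univ
      (fun u _ => ((Real.hasDerivAt_exp u).const_mul (y / 2)).hasDerivWithinAt)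
      (fun u _ u' _ h => Real.exp_injective (mul_left_cancel₀ hy2.ne' h)), Measure.restrict_univ]
    have e : ∀ u : ℝ, ENNReal.ofReal |y / 2 * Real.exp u| * ENNReal.ofReal
        ((y / 2 * Real.exp u) ^ (μ - 1) *
          Real.exp (-(y / 2 * Real.exp u) - y ^ 2 / (4 * (y / 2 * Real.exp u)))) =
        ENNReal.ofReal ((y / 2) ^ μ * (Real.exp (-y * Real.cosh u) * Real.exp (μ * u))) := by
      intro u
      have hpos : 0 < y / 2 * Real.exp u := by positivity
      rw [← ENNReal.ofReal_mul (abs_nonneg _), abs_of_pos hpos]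
      congr 1
      have h1 : (y / 2 * Real.exp u) * (y / 2 * Real.exp u) ^ (μ - 1) =
          (y / 2) ^ μ * Real.exp (μ * u) := by
        rw [← Real.rpow_one_add' hpos.le (by linarith), add_sub_cancel,
          Real.mul_rpow hy2.le (Real.exp_pos _).le, ← Real.exp_mul, mul_comm u]
      have h2 : -(y / 2 * Real.exp u) - y ^ 2 / (4 * (y / 2 * Real.exp u)) =
          -y * Real.cosh u := by
        rw [Real.cosh_eq, Real.exp_neg]
        field_simp
        ring
      rw [h2, ← mul_assoc, h1]
      ring
    simp only [e]
    rw [lintegral_eq_lintegral_Ioi_add_comp_neg (by fun_prop)]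
    refine lintegral_congr fun u => ?_
    rw [← ENNReal.ofReal_add (by positivity) (by positivity)]
    congr 1
    rw [Real.cosh_neg, Real.cosh_eq (-μ * u)]
    ring_nf
  -- Finiteness, by comparison with Euler's Gamma integral, ensures that the Bochner integral in
  -- `macdonaldK` is the true value and not the default `0`.
  have hfin : ∫⁻ z in Ioi (0 : ℝ),
      ENNReal.ofReal (z ^ (μ - 1) * Real.exp (-z - y ^ 2 / (4 * z))) ≠ ∞ := by
    have h1 : IntegrableOn (fun z : ℝ => Real.exp (-z) * z ^ (μ - 1)) (Ioi 0) :=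
      Real.GammaIntegral_convergent hμ
    refine ne_top_of_le_ne_top h1.lintegral_lt_top.ne ?_
    refine setLIntegral_mono' measurableSet_Ioi fun z hz => ENNReal.ofReal_le_ofReal ?_
    have hz' : 0 < z := hz
    rw [mul_comm]
    gcongr
    have : 0 ≤ y ^ 2 / (4 * z) := by positivity
    linarith
  rw [hcv] at hfin ⊢
  rw [macdonaldK, ← integral_const_mul, integral_eq_lintegral_of_nonneg_ae
    (.of_forall fun u => by positivity) (by fun_prop), ENNReal.ofReal_toReal hfin]

theorem macdonaldK_nonneg (μ y : ℝ) : 0 ≤ macdonaldK μ y :=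
  integral_nonneg fun u => by positivity

theorem lintegral_gammaMeasure (a r : ℝ) (f : ℝ → ℝ≥0∞) : ∫⁻ z, f z ∂gammaMeasure a r =
    ∫⁻ z in Ioi (0 : ℝ),
      ENNReal.ofReal (r ^ a / Real.Gamma a * z ^ (a - 1) * Real.exp (-(r * z))) * f z := by
  rw [gammaMeasure, lintegral_withDensity_eq_lintegral_mul_non_measurable _
    (show Measurable (gammaPDF a r) by unfold gammaPDF; fun_prop) (.of_forall fun z => ENNReal.ofReal_lt_top),
    ← lintegral_add_compl _ (measurableSet_Ioi (a := (0 : ℝ))), compl_Ioi,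
    ← restrict_Iio_eq_restrict_Iic]
  have h : ∫⁻ z in Iio (0 : ℝ), (gammaPDF a r * f) z = 0 := by
    rw [setLIntegral_congr_fun measurableSet_Iio (g := fun _ => 0) fun z hz => ?_]
    · simp
    · simp [gammaPDF_of_neg (show z < 0 from hz)]
  rw [h, add_zero]
  refine setLIntegral_congr_fun measurableSet_Ioi fun z hz => ?_
  simp [gammaPDF_of_nonneg (le_of_lt (show 0 < z from hz))]

/-- A centred Gaussian density whose variance is a multiple of a Gamma variable. -/
theorem lintegral_gaussianPDF_gammaMeasure {c t α w x : ℝ} (hc : 0 < c) (ht : 0 < t) (hα : 0 < α)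
    (hw : 0 < w) (hx : x ≠ 0) :
    ∫⁻ z, gaussianPDF 0 (Real.toNNReal (2 * c ^ 2 / t ^ 2 * (z * w))) x
        ∂gammaMeasure ((α + 1) / 2) 1 =
      ENNReal.ofReal (1 / Real.Gamma ((α + 1) / 2) * ((t / (√(Real.pi * w) * c)) *
        (t * |x| / (2 * c * √w)) ^ (α / 2) * macdonaldK (-(α / 2)) (t * |x| / (c * √w)))) := by
  have hx' : 0 < |x| := abs_pos.2 hx
  have hsw : 0 < √w := Real.sqrt_pos.2 hw
  have hG : 0 < Real.Gamma ((α + 1) / 2) := Real.Gamma_pos_of_pos (by positivity)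
  have hspw : 0 < √(Real.pi * w) := Real.sqrt_pos.2 (by positivity)
  have hy : 0 < t * |x| / (c * √w) := by positivity
  have key := lintegral_rpow_mul_exp_eq_macdonaldK (half_pos hα) hy
  rw [lintegral_gammaMeasure]
  -- The Gaussian normalisation removes `√z`, which lowers the exponent `(α + 1) / 2 - 1` to `α / 2
  -- - 1`. The Gaussian exponent is `-y² / (4z)` with `y = t|x| / (c√w)`.
  have e : ∀ z ∈ Ioi (0 : ℝ), ENNReal.ofReal (1 ^ ((α + 1) / 2) / Real.Gamma ((α + 1) / 2) *
        z ^ ((α + 1) / 2 - 1) * Real.exp (-(1 * z))) *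
        gaussianPDF 0 (Real.toNNReal (2 * c ^ 2 / t ^ 2 * (z * w))) x =
      ENNReal.ofReal (1 / Real.Gamma ((α + 1) / 2) * (t / (√(Real.pi * w) * c)) * (1 / 2)) *
        ENNReal.ofReal (z ^ (α / 2 - 1) *
          Real.exp (-z - (t * |x| / (c * √w)) ^ 2 / (4 * z))) := by
    intro z hz
    have hz' : 0 < z := hz
    have hsz : 0 < √z := Real.sqrt_pos.2 hz'
    rw [gaussianPDF, ← ENNReal.ofReal_mul (by positivity), ← ENNReal.ofReal_mul (by positivity)]
    congr 1
    rw [gaussianPDFReal, Real.coe_toNNReal _ (by positivity), sub_zero, Real.one_rpow, one_mul]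
    have h1 : √(2 * Real.pi * (2 * c ^ 2 / t ^ 2 * (z * w))) =
        2 * c / t * (√(Real.pi * w) * √z) := by
      rw [← Real.sqrt_mul (by positivity), show 2 * Real.pi * (2 * c ^ 2 / t ^ 2 * (z * w)) =
        (2 * c / t) ^ 2 * (Real.pi * w * z) by ring, Real.sqrt_mul (by positivity),
        Real.sqrt_sq (by positivity)]
    have h2 : -x ^ 2 / (2 * (2 * c ^ 2 / t ^ 2 * (z * w))) =
        -((t * |x| / (c * √w)) ^ 2 / (4 * z)) := by
      rw [div_pow, mul_pow, mul_pow, sq_abs, Real.sq_sqrt hw.le]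
      field_simp
      ring
    have h3 : z ^ ((α + 1) / 2 - 1) = z ^ (α / 2 - 1) * √z := by
      rw [Real.sqrt_eq_rpow, ← Real.rpow_add hz']
      congr 1
      ring
    have h4 : Real.exp (-z - (t * |x| / (c * √w)) ^ 2 / (4 * z)) =
        Real.exp (-z) * Real.exp (-((t * |x| / (c * √w)) ^ 2 / (4 * z))) := by
      rw [← Real.exp_add, sub_eq_add_neg]
    rw [h1, h2, h3, h4]
    field_simp
  rw [setLIntegral_congr_fun measurableSet_Ioi e, lintegral_const_mul _ (by fun_prop), key,
    ← ENNReal.ofReal_mul (by positivity)]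
  congr 1
  rw [show t * |x| / (c * √w) / 2 = t * |x| / (2 * c * √w) by field_simp]
  ring

theorem measurable_gaussianPDF_comp {β : Type*} [MeasurableSpace β] {v x : β → ℝ}
    (hv : Measurable v) (hx : Measurable x) :
    Measurable fun b => gaussianPDF 0 (Real.toNNReal (v b)) (x b) :=
  measurable_uncurry_gaussianPDF.comp
    (measurable_const.prodMk ((measurable_real_toNNReal.comp hv).prodMk hx))

theorem gaussianMixture_apply_eq_lintegral_gaussianPDF {σ a₁ a b : ℝ} (hσ : 0 < σ) (ha₁ : 0 < a₁)
    (ha : 0 < a) (hb : 0 < b) {B : Set ℝ} (hB : MeasurableSet B) :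
    gaussianMixture σ a₁ a b B =
      ∫⁻ x in B, ∫⁻ w, ∫⁻ z, gaussianPDF 0 (Real.toNNReal (σ * (z * w))) x
        ∂gammaMeasure a₁ 1 ∂betaMeasure a b := by
  have := isProbabilityMeasure_gammaMeasure ha₁ one_pos
  have := isProbabilityMeasureBeta ha hb
  rw [gaussianMixture_apply ha₁ ha hb hB]
  have h1 : ∀ᵐ z ∂gammaMeasure a₁ 1,
      ∫⁻ w, gaussianReal 0 (Real.toNNReal (σ * (z * w))) B ∂betaMeasure a b =
      ∫⁻ x in B, ∫⁻ w, gaussianPDF 0 (Real.toNNReal (σ * (z * w))) x ∂betaMeasure a b := by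
    filter_upwards [ae_pos_gammaMeasure a₁ 1] with z hz
    rw [lintegral_lintegral_swap
      (measurable_gaussianPDF_comp (by fun_prop) (by fun_prop)).aemeasurable]
    refine lintegral_congr_ae ?_
    filter_upwards [ae_mem_Ioo_betaMeasure a b] with w hw
    have hw0 := hw.1
    exact gaussianReal_apply 0 (Real.toNNReal_pos.2 (by positivity)).ne' B
  rw [lintegral_congr_ae h1, lintegral_lintegral_swap]
  · refine lintegral_congr fun x => ?_
    rw [lintegral_lintegral_swap
      (measurable_gaussianPDF_comp (by fun_prop) (by fun_prop)).aemeasurable]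
  · refine (Measurable.lintegral_prod_right' (f := fun p : (ℝ × ℝ) × ℝ =>
      gaussianPDF 0 (Real.toNNReal (σ * (p.1.1 * p.2))) p.1.2) ?_).aemeasurable
    exact measurable_gaussianPDF_comp (by fun_prop) (by fun_prop)

theorem lintegral_betaMeasure (a b : ℝ) {f : ℝ → ℝ≥0∞} (hf : Measurable f) :
    ∫⁻ w, f w ∂betaMeasure a b = ∫⁻ w in Ioo (0 : ℝ) 1, betaPDF a b w * f w := by
  rw [betaMeasure, lintegral_withDensity_eq_lintegral_mul _ (by unfold betaPDF; fun_prop) hf,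
    ← lintegral_indicator measurableSet_Ioo]
  refine lintegral_congr fun w => ?_
  by_cases hw : w ∈ Ioo (0 : ℝ) 1
  · rw [indicator_of_mem hw]; rfl
  · rw [indicator_of_notMem hw, Pi.mul_apply, betaPDF_eq, if_neg (by simpa using hw)]
    simp

/-- The finiteness hypothesis allows the passage to the interval integral, which would be `0` by
convention if it diverged. -/
theorem lintegral_betaMeasure_eq_ofReal {a b : ℝ} (ha : 0 < a) (hb : 0 < b) {J : ℝ → ℝ≥0∞}
    (hJ : Measurable J) (hfin : ∫⁻ w, J w ∂betaMeasure a b < ∞) {k : ℝ → ℝ} (hk : ∀ w, 0 ≤ k w)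
    (hJk : ∀ w ∈ Ioo (0 : ℝ) 1, J w = ENNReal.ofReal (k w)) :
    ∫⁻ w, J w ∂betaMeasure a b = ENNReal.ofReal (1 / beta a b *
      ∫ w in (0 : ℝ)..1, w ^ (a - 1) * (1 - w) ^ (b - 1) * k w) := by
  have hB := beta_pos ha hb
  rw [lintegral_betaMeasure a b hJ] at hfin ⊢
  rw [← ENNReal.ofReal_toReal hfin.ne, ← integral_toReal]
  · rw [intervalIntegral.integral_of_le zero_le_one, integral_Ioc_eq_integral_Ioo,
      ← integral_const_mul]
    congr 1
    refine setIntegral_congr_fun measurableSet_Ioo fun w hw => ?_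
    have hw0 := hw.1
    have hw1 : 0 < 1 - w := sub_pos.2 hw.2
    rw [hJk w hw, betaPDF_of_pos_lt_one hw.1 hw.2, ENNReal.toReal_mul,
      ENNReal.toReal_ofReal (by positivity), ENNReal.toReal_ofReal (hk w)]
    ring
  · exact ((by unfold betaPDF; fun_prop : Measurable (betaPDF a b)).mul hJ).aemeasurable
  · refine (ae_restrict_iff' measurableSet_Ioo).2 (.of_forall fun w hw => ?_)
    rw [hJk w hw]
    exact ENNReal.mul_lt_top ENNReal.ofReal_lt_top ENNReal.ofReal_lt_top

/-- The density of the Gaussian mixture. -/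
theorem gaussianMixture_eq_lintegral {c t α v : ℝ} (hc : 0 < c) (ht : 0 < t) (hα : 0 < α)
    (hv : α / 2 - 1 < v) {A : Set ℝ} (hA : MeasurableSet A) :
    gaussianMixture (2 * c ^ 2 / t ^ 2) ((α + 1) / 2) (α / 2) (v - α / 2 + 1) A =
      ∫⁻ x in A, ENNReal.ofReal (gammaTimeDensity c t α v x) := by
  have ha₁ : 0 < (α + 1) / 2 := by positivity
  have ha : 0 < α / 2 := by positivity
  have hb : 0 < v - α / 2 + 1 := by linarith
  have hσ : 0 < 2 * c ^ 2 / t ^ 2 := by positivity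
  have := isProbabilityMeasure_gammaMeasure ha₁ one_pos
  have := isProbabilityMeasureBeta ha hb
  have := isProbabilityMeasure_gaussianMixture (σ := 2 * c ^ 2 / t ^ 2) ha₁ ha hb
  have hJm : Measurable fun p : ℝ × ℝ =>
      ∫⁻ z, gaussianPDF 0 (Real.toNNReal (2 * c ^ 2 / t ^ 2 * (z * p.2))) p.1
        ∂gammaMeasure ((α + 1) / 2) 1 :=
    Measurable.lintegral_prod_right' (f := fun p : (ℝ × ℝ) × ℝ =>
        gaussianPDF 0 (Real.toNNReal (2 * c ^ 2 / t ^ 2 * (p.2 * p.1.2))) p.1.1)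
      (measurable_gaussianPDF_comp (by fun_prop) (by fun_prop))
  -- The mixture has finite mass, so its density, computed in `ℝ≥0∞`, is finite almost everywhere.
  have hfin := ae_lt_top (μ := volume) (hJm.lintegral_prod_right'
    (ν := betaMeasure (α / 2) (v - α / 2 + 1))) (by
      have h := gaussianMixture_apply_eq_lintegral_gaussianPDF hσ ha₁ ha hb MeasurableSet.univ
      rw [Measure.restrict_univ] at h
      exact h ▸ measure_ne_top _ _)
  rw [gaussianMixture_apply_eq_lintegral_gaussianPDF hσ ha₁ ha hb hA]
  refine lintegral_congr_ae (ae_restrict_of_ae ?_)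
  have hx0 : ∀ᵐ x : ℝ, x ≠ 0 := by simp [ae_iff]
  filter_upwards [hfin, hx0] with x hx hx0
  refine (lintegral_betaMeasure_eq_ofReal ha hb (hJm.comp measurable_prodMk_left) hx
    (k := fun w => 1 / Real.Gamma ((α + 1) / 2) * ((t / (√(Real.pi * w) * c)) *
      (t * |x| / (2 * c * √w)) ^ (α / 2) * macdonaldK (-(α / 2)) (t * |x| / (c * √w))))
    (fun w => ?_)
    fun w hw => lintegral_gaussianPDF_gammaMeasure hc ht hα hw.1 hx0).trans ?_
  rotate_left
  · rw [gammaTimeDensity, ← intervalIntegral.integral_const_mul,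
      ← intervalIntegral.integral_const_mul]
    congr 1
    refine intervalIntegral.integral_congr fun w _ => ?_
    rw [show v - α / 2 + 1 - 1 = v - α / 2 by ring, ← one_div_mul_one_div]
    ring
  · have hG := Real.Gamma_pos_of_pos ha₁
    have hK := macdonaldK_nonneg (-(α / 2)) (t * |x| / (c * √w))
    positivity

/-! ### The flight with a Gamma elapsed time -/

noncomputable section

/-- The ratio of the densities of two Gamma laws. -/
def gammaRatio (α t a r s : ℝ) : ℝ := gammaPDFReal α t s / gammaPDFReal a r s

/-- The law of `c` times the position after `n + 1` displacements, when the law of the elapsed time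
is changed into a Gamma law. -/
def gammaTimeLaw (c r t α : ℝ) (κ : Measure ℝ) (n : ℕ) : Measure ℝ :=
  ((flightLaw r κ (n + 1)).withDensity
    fun p => ENNReal.ofReal (gammaRatio α t (n + 1) r p.1)).map fun p => c * p.2

end

section

variable {α t a r : ℝ}

@[fun_prop]
theorem measurable_gammaRatio : Measurable (gammaRatio α t a r) := by
  unfold gammaRatio; fun_prop

theorem gammaRatio_nonneg (hα : 0 < α) (ht : 0 < t) (ha : 0 < a) (hr : 0 < r) (s : ℝ) :
    0 ≤ gammaRatio α t a r s :=
  div_nonneg (gammaPDFReal_nonneg hα ht s) (gammaPDFReal_nonneg ha hr s)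

theorem gammaPDFReal_mul_gammaRatio (ha : 0 < a) (hr : 0 < r) :
    ∀ᵐ s : ℝ, gammaPDFReal a r s * gammaRatio α t a r s = 1 * gammaPDFReal α t s := by
  have h0 : ∀ᵐ x : ℝ, x ≠ 0 := by simp [ae_iff]
  filter_upwards [h0] with s hs
  rcases lt_or_gt_of_ne hs with h | h
  -- On the negative half-line both densities vanish, and the quotient is `0 / 0 = 0`.
  · simp [gammaPDFReal, h.not_ge]
  · have := (gammaPDFReal_pos ha hr h).ne'
    rw [gammaRatio]
    field_simp

theorem gammaMeasure_withDensity_gammaRatio (ha : 0 < a) (hr : 0 < r) :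
    (gammaMeasure a r).withDensity (fun s => ENNReal.ofReal (gammaRatio α t a r s)) =
      gammaMeasure α t := by
  rw [gammaMeasure, ← withDensity_mul _ (by unfold gammaPDF; fun_prop) (by fun_prop)]
  refine withDensity_congr_ae ?_
  filter_upwards [gammaPDFReal_mul_gammaRatio (α := α) (t := t) ha hr] with s hs
  rw [Pi.mul_apply, gammaPDF, gammaPDF, ← one_mul (gammaPDFReal α t s), ← hs,
    ENNReal.ofReal_mul (gammaPDFReal_nonneg ha hr s)]

/-- Shape `a + k` is a weight `s ^ k` on shape `a`, and the ratio then exchanges the two Gamma laws.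
What is left is the `k`-th moment of the target law. -/
theorem integral_gammaRatio_gammaMeasure (hα : 0 < α) (ht : 0 < t) (ha : 0 < a) (hr : 0 < r)
    (k : ℕ) : ∫ s, gammaRatio α t a r s ∂gammaMeasure (a + k) r =
      Real.Gamma a * r ^ k / Real.Gamma (a + k) * (Real.Gamma (α + k) / (Real.Gamma α * t ^ k)) := by
  rw [← integral_pow_gammaMeasure hα ht]
  have h1 := integral_pow_mul_gammaMeasure ha hr k (gammaRatio α t a r)
  have h2 := integral_withDensity_tilt (g := fun s => s ^ k) (measurable_gammaPDFReal a r)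
    (gammaPDFReal_nonneg ha hr) (measurable_gammaPDFReal α t) (gammaPDFReal_nonneg hα ht)
    (gammaPDFReal_mul_gammaRatio ha hr)
  change ∫ s, _ * s ^ k ∂gammaMeasure a r = 1 * ∫ s, s ^ k ∂gammaMeasure α t at h2
  rw [one_mul] at h2
  rw [← h2]
  simp only [mul_comm (gammaRatio α t a r _)]
  rw [h1]
  have := (Real.Gamma_pos_of_pos ha).ne'
  have := (Real.Gamma_pos_of_pos (show 0 < a + k by positivity)).ne'
  field_simp

theorem integrable_gammaRatio_gammaMeasure (hα : 0 < α) (ht : 0 < t) (ha : 0 < a) (hr : 0 < r)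
    (k : ℕ) : Integrable (gammaRatio α t a r) (gammaMeasure (a + k) r) := by
  have := isProbabilityMeasure_gammaMeasure (a := α + k) (by positivity) ht
  rw [← integrable_pow_mul_gammaMeasure ha hr k]
  have h1 : Integrable (fun s => s ^ k * 1) (gammaMeasure α t) :=
    (integrable_pow_mul_gammaMeasure hα ht k).2 (integrable_const _)
  have h2 := (integrable_withDensity_tilt (g := fun s => s ^ k) (measurable_gammaPDFReal a r)
    (gammaPDFReal_nonneg ha hr) (measurable_gammaPDFReal α t) (gammaPDFReal_nonneg hα ht)
    one_ne_zero (gammaPDFReal_mul_gammaRatio ha hr)).2 (by simpa using! h1)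
  change Integrable _ (gammaMeasure a r) at h2
  simpa only [mul_comm] using h2

end

section

variable {c r t α : ℝ} {κ : Measure ℝ}

/-- The weight depends on the time alone, so it acts on the time marginal, known to be Gamma of
shape `n + 1`. -/
theorem map_fst_withDensity_gammaRatio (hr : 0 < r) [IsProbabilityMeasure κ] (n : ℕ) :
    ((flightLaw r κ (n + 1)).withDensity
      fun p => ENNReal.ofReal (gammaRatio α t (n + 1) r p.1)).map Prod.fst = gammaMeasure α t := by
  rw [← gammaMeasure_withDensity_gammaRatio (a := (n : ℝ) + 1) (by positivity) hr,
    ← map_fst_flightLaw (κ := κ) hr n]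
  ext A hA
  rw [Measure.map_apply measurable_fst hA, withDensity_apply _ (measurable_fst hA),
    withDensity_apply _ hA, setLIntegral_map hA (by fun_prop) measurable_fst]

theorem isProbabilityMeasure_gammaTimeLaw (hr : 0 < r) (hα : 0 < α) (ht : 0 < t)
    [IsProbabilityMeasure κ] (n : ℕ) : IsProbabilityMeasure (gammaTimeLaw c r t α κ n) := by
  have h := map_fst_withDensity_gammaRatio (α := α) (t := t) (κ := κ) hr n
  have := isProbabilityMeasure_gammaMeasure hα ht
  rw [← h] at this
  have := Measure.isProbabilityMeasure_of_map (μ := (flightLaw r κ (n + 1)).withDensity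
    fun p => ENNReal.ofReal (gammaRatio α t (n + 1) r p.1)) Prod.fst
  exact Measure.isProbabilityMeasure_map (by fun_prop)

/-- The powers of `r` from `integral_flightLaw` and from the density ratio cancel: the Poisson rate
leaves no trace. -/
theorem integral_pow_gammaTimeLaw (hr : 0 < r) (hα : 0 < α) (ht : 0 < t)
    [IsProbabilityMeasure κ] (hκ : ∀ᵐ z ∂κ, |z| ≤ 1) (n k : ℕ) :
    ∫ x, x ^ k ∂gammaTimeLaw c r t α κ n =
      c ^ k * k.factorial * (momentSeries κ ^ (n + 1)).coeff k *
        (n.factorial / (n + k).factorial) * ∫ s, s ^ k ∂gammaMeasure α t := by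
  rw [gammaTimeLaw, integral_map (by fun_prop) (by fun_prop),
    integral_withDensity_eq_integral_toReal_smul (by fun_prop) (by simp)]
  have e : ∀ p : ℝ × ℝ, (ENNReal.ofReal (gammaRatio α t (n + 1) r p.1)).toReal • (c * p.2) ^ k =
      c ^ k * (p.2 ^ k * gammaRatio α t (n + 1) r p.1) := by
    intro p
    rw [ENNReal.toReal_ofReal (gammaRatio_nonneg hα ht (by positivity) hr _), smul_eq_mul]
    ring
  simp only [e]
  rw [integral_const_mul, integral_flightLaw hr hκ n k (by fun_prop)
    (integrable_gammaRatio_gammaMeasure hα ht (by positivity) hr k),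
    integral_gammaRatio_gammaMeasure hα ht (by positivity) hr, integral_pow_gammaMeasure hα ht,
    Real.Gamma_nat_eq_factorial, show (n : ℝ) + 1 + k = ((n + k : ℕ) : ℝ) + 1 by push_cast; ring,
    Real.Gamma_nat_eq_factorial]
  field_simp

theorem zero_mem_interior_integrableExpSet_gammaTimeLaw (hc : 0 < c) (hr : 0 < r) (hα : 0 < α)
    (ht : 0 < t) [IsProbabilityMeasure κ] (hκ : ∀ᵐ z ∂κ, |z| ≤ 1) (n : ℕ) :
    0 ∈ interior (integrableExpSet id (gammaTimeLaw c r t α κ n)) := by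
  rw [mem_interior_iff_mem_nhds]
  have hnear : ∀ᶠ u : ℝ in nhds 0, |u| * c < t := by
    have h : Filter.Tendsto (fun u : ℝ => |u| * c) (nhds 0) (nhds (|0| * c)) :=
      (by fun_prop : Continuous fun u : ℝ => |u| * c).tendsto 0
    exact h.eventually (gt_mem_nhds (by simpa using ht))
  filter_upwards [hnear] with u hu
  simp only [integrableExpSet, mem_ofPred_eq, id]
  rw [gammaTimeLaw, integrable_map_measure (by fun_prop) (by fun_prop)]
  have h1 := integrable_exp_mul_gammaMeasure hα ht hu
  rw [← map_fst_withDensity_gammaRatio (κ := κ) hr n,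
    integrable_map_measure (by fun_prop) (by fun_prop)] at h1
  refine h1.mono (by fun_prop) ?_
  filter_upwards [(withDensity_absolutelyContinuous _ _).ae_le
    (ae_abs_snd_le_fst_flightLaw hr hκ (n + 1))] with p hp
  simp only [Function.comp_apply, Real.norm_eq_abs, Real.abs_exp, Real.exp_le_exp]
  calc u * (c * p.2) ≤ |u * (c * p.2)| := le_abs_self _
    _ = |u| * c * |p.2| := by rw [abs_mul, abs_mul, abs_of_pos hc, mul_assoc]
    _ ≤ |u| * c * p.1 := by gcongr

theorem ae_abs_le_one_cosLaw (ν : ℝ) : ∀ᵐ z ∂cosLaw ν, |z| ≤ 1 := by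
  rw [cosLaw, ae_map_iff (by fun_prop) (measurableSet_le (by fun_prop) (by fun_prop))]
  exact .of_forall fun θ => Real.abs_cos_le_one θ

/-- Both sequences of even moments start at one and have the ratio `c² (2k + 1)(α + 2k)(α + 2k + 1)
/ (2t² (v + 1 + k))`, with `v = motionIndex m n`. The shapes `α / 2` and `(α + 1) / 2` come from
splitting `(α + 2k)(α + 2k + 1)`, and the second Beta parameter is chosen so that the two add up to
`v + 1`. -/
theorem gammaTimeLaw_eq_gaussianMixture (hc : 0 < c) (hr : 0 < r) (hα : 0 < α) (ht : 0 < t)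
    (m : Fin 2) (n : ℕ) [IsProbabilityMeasure (cosLaw ((m : ℕ) : ℝ))]
    (hv : α / 2 - 1 < motionIndex m n) :
    gammaTimeLaw c r t α (cosLaw ((m : ℕ) : ℝ)) n =
      gaussianMixture (2 * c ^ 2 / t ^ 2) ((α + 1) / 2) (α / 2) (motionIndex m n - α / 2 + 1) := by
  have ha₁ : 0 < (α + 1) / 2 := by positivity
  have ha : 0 < α / 2 := by positivity
  have hb : 0 < motionIndex m n - α / 2 + 1 := by linarith
  have hσ : 0 < 2 * c ^ 2 / t ^ 2 := by positivity
  have hκ := ae_abs_le_one_cosLaw ((m : ℕ) : ℝ)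
  have hm : (m : ℕ) = 0 ∨ (m : ℕ) = 1 := by omega
  have := isProbabilityMeasure_gaussianMixture (σ := 2 * c ^ 2 / t ^ 2) ha₁ ha hb
  have := isProbabilityMeasure_gammaTimeLaw (c := c) (κ := cosLaw ((m : ℕ) : ℝ)) hr hα ht n
  refine Measure.ext_of_moments (zero_mem_interior_integrableExpSet_gammaTimeLaw hc hr hα ht hκ n)
    (zero_mem_interior_integrableExpSet_gaussianMixture hσ ha₁ ha hb) fun j => ?_
  obtain ⟨k, rfl | rfl⟩ := Nat.even_or_odd' j
  · induction k with
    | zero => simp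
    | succ k ih =>
      rw [integral_pow_even_succ_gaussianMixture k hσ.le ha₁ ha hb, ← ih,
        integral_pow_gammaTimeLaw hr hα ht hκ, integral_pow_gammaTimeLaw hr hα ht hκ,
        show 2 * (k + 1) = 2 * k + 1 + 1 by ring, integral_pow_succ_gammaMeasure hα ht,
        integral_pow_succ_gammaMeasure hα ht, Nat.factorial_succ (2 * k + 1),
        Nat.factorial_succ (2 * k), show n + (2 * k + 1 + 1) = n + 2 * k + 1 + 1 by ring,
        Nat.factorial_succ (n + 2 * k + 1), Nat.factorial_succ (n + 2 * k)]
      have hv0 : 0 < motionIndex m n + 1 + k := by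
        have : (0 : ℝ) ≤ k := by positivity
        linarith
      have hcoef : (momentSeries (cosLaw ((m : ℕ) : ℝ)) ^ (n + 1)).coeff (2 * k + 1 + 1) =
          (momentSeries (cosLaw ((m : ℕ) : ℝ)) ^ (n + 1)).coeff (2 * k) *
            (1 / 2 * ((n + 2 * k + 1) * (n + 2 * k + 2))) /
              ((2 * k + 2) * (motionIndex m n + 1 + k)) := by
        rw [eq_div_iff (by positivity), ← coeff_even_momentSeries_pow_succ m n k]
        rfl
      rw [hcoef, show α / 2 + (motionIndex m n - α / 2 + 1) + (k : ℝ) = motionIndex m n + 1 + k by ring]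
      push_cast
      field_simp
      ring
  · rw [integral_pow_odd_gaussianMixture k ha₁ ha hb, integral_pow_gammaTimeLaw hr hα ht hκ,
      coeff_odd_momentSeries_pow hm]
    simp

end

/-! ### Observation at a fixed time -/

/-- The motion is observed at the time `s` between the beginning and the end of the current
displacement, at a position that `c` scales into `A`. -/
def observed (c : ℝ) (A : Set ℝ) (s : ℝ) : Set ((ℝ × ℝ) × (ℝ × ℝ)) :=
  {q | q.1.1 ≤ s ∧ s < q.1.1 + q.2.1 ∧ c * (q.1.2 + (s - q.1.1) * q.2.2) ∈ A}

theorem measurableSet_observed_prod (c : ℝ) {A : Set ℝ} (hA : MeasurableSet A) :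
    MeasurableSet {x : ℝ × ((ℝ × ℝ) × (ℝ × ℝ)) | x.2 ∈ observed c A x.1} := by
  have h1 : MeasurableSet {x : ℝ × ((ℝ × ℝ) × (ℝ × ℝ)) | x.2.1.1 ≤ x.1} :=
    measurableSet_le (by fun_prop) (by fun_prop)
  have h2 : MeasurableSet {x : ℝ × ((ℝ × ℝ) × (ℝ × ℝ)) | x.1 < x.2.1.1 + x.2.2.1} :=
    measurableSet_lt (by fun_prop) (by fun_prop)
  have h3 : Measurable fun x : ℝ × ((ℝ × ℝ) × (ℝ × ℝ)) =>
    c * (x.2.1.2 + (x.1 - x.2.1.1) * x.2.2.2) := by fun_prop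
  exact h1.inter (h2.inter (h3 hA))

theorem measurableSet_observed (c : ℝ) {A : Set ℝ} (hA : MeasurableSet A) (s : ℝ) :
    MeasurableSet (observed c A s) :=
  measurable_prodMk_left (measurableSet_observed_prod c hA)

/-- The density of the exponential law is its rate times its tail. -/
theorem lintegral_tail_expMeasure {r : ℝ} (hr : 0 < r) {h : ℝ → ℝ≥0∞} (hh : Measurable h) :
    ENNReal.ofReal r * ∫⁻ e, (∫⁻ u, (Ico 0 e).indicator h u) ∂expMeasure r =
      ∫⁻ u, h u ∂expMeasure r := by
  have := isProbabilityMeasure_expMeasure hr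
  have hset : MeasurableSet {p : ℝ × ℝ | p.2 ∈ Ico 0 p.1} :=
    (measurableSet_le measurable_const measurable_snd).inter
      (measurableSet_lt measurable_snd measurable_fst)
  have hm : Measurable fun p : ℝ × ℝ => (Ico 0 p.1).indicator h p.2 := by
    exact (hh.comp measurable_snd).indicator hset
  rw [lintegral_lintegral_swap hm.aemeasurable]
  have htail : ∀ u : ℝ, 0 ≤ u → expMeasure r (Ioi u) = ENNReal.ofReal (Real.exp (-(r * u))) := by
    intro u hu
    have h1 := cdf_expMeasure_eq hr u
    rw [if_pos hu, cdf_eq_real] at h1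
    rw [← compl_Iic, prob_compl_eq_one_sub measurableSet_Iic, ← ofReal_measureReal, h1,
      ← ENNReal.ofReal_one, ← ENNReal.ofReal_sub]
    · congr 1; ring
    · rw [sub_nonneg, Real.exp_le_one_iff]; nlinarith
  rw [← lintegral_const_mul _ hm.lintegral_prod_left]
  conv_rhs => rw [expMeasure, lintegral_gammaMeasure, ← lintegral_indicator measurableSet_Ioi]
  have h0 : ∀ᵐ x : ℝ, x ≠ 0 := by simp [ae_iff]
  refine lintegral_congr_ae ?_
  filter_upwards [h0] with u hu0
  rcases lt_or_gt_of_ne hu0 with hu | hu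
  · rw [indicator_of_notMem (by simpa using hu.le)]
    simp [indicator, hu.not_ge]
  · rw [indicator_of_mem (by simpa using hu)]
    have : ∀ e, (Ico 0 e).indicator h u = h u * (Ioi u).indicator 1 e := by
      intro e
      by_cases he : u < e <;> simp [indicator, hu.le, he]
    simp only [this]
    rw [lintegral_const_mul _ (measurable_one.indicator measurableSet_Ioi),
      lintegral_indicator_one measurableSet_Ioi, htail u hu.le, mul_left_comm, mul_comm (h u),
      ← ENNReal.ofReal_mul hr.le]
    simp

section

variable {c r t α : ℝ} {κ : Measure ℝ}

/-- Integrating the observation probabilities over the time gives the law after one more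
displacement. -/
theorem lintegral_observed (hr : 0 < r) [IsProbabilityMeasure κ] (n : ℕ) {A : Set ℝ}
    (hA : MeasurableSet A) {g : ℝ → ℝ≥0∞} (hg : Measurable g) :
    ∫⁻ s, g s * (ENNReal.ofReal r *
        (flightLaw r κ n).prod ((expMeasure r).prod κ) (observed c A s)) =
      ∫⁻ p, g p.1 * A.indicator 1 (c * p.2) ∂flightLaw r κ (n + 1) := by
  have := isProbabilityMeasure_expMeasure hr
  have := isProbabilityMeasure_flightLaw (κ := κ) hr n
  set Λ := (flightLaw r κ n).prod ((expMeasure r).prod κ) with hΛ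
  have hH : Measurable fun x : ℝ × ((ℝ × ℝ) × (ℝ × ℝ)) =>
      g x.1 * (observed c A x.1).indicator (1 : (ℝ × ℝ) × (ℝ × ℝ) → ℝ≥0∞) x.2 :=
    (hg.comp measurable_fst).mul (measurable_one.indicator (measurableSet_observed_prod c hA))
  have hind : Measurable (A.indicator (1 : ℝ → ℝ≥0∞)) := measurable_one.indicator hA
  have h1 : ∀ s, g s * (ENNReal.ofReal r * Λ (observed c A s)) = ENNReal.ofReal r *
      ∫⁻ q, g s * (observed c A s).indicator (1 : (ℝ × ℝ) × (ℝ × ℝ) → ℝ≥0∞) q ∂Λ := by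
    intro s
    rw [lintegral_const_mul _ (measurable_one.indicator (measurableSet_observed c hA s)),
      lintegral_indicator_one (measurableSet_observed c hA s), mul_left_comm]
  -- The variable becomes the time `u` elapsed since the last event. Then the condition on the
  -- current duration `e` is `0 ≤ u < e`, and the tail identity replaces the truncated displacement
  -- by a complete one.
  have h2 : ∀ q : (ℝ × ℝ) × (ℝ × ℝ),
      ∫⁻ s, g s * (observed c A s).indicator (1 : (ℝ × ℝ) × (ℝ × ℝ) → ℝ≥0∞) q =
      ∫⁻ u, (Ico 0 q.2.1).indicator
        (fun u => g (q.1.1 + u) * A.indicator 1 (c * (q.1.2 + u * q.2.2))) u := by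
    intro q
    rw [← lintegral_add_left_eq_self _ q.1.1]
    refine lintegral_congr fun u => ?_
    by_cases hu : 0 ≤ u <;> by_cases hu' : u < q.2.1 <;>
      by_cases hx : c * (q.1.2 + u * q.2.2) ∈ A <;> simp [observed, indicator, hu, hu', hx]
  simp only [h1]
  rw [lintegral_const_mul' _ _ ENNReal.ofReal_ne_top, lintegral_lintegral_swap hH.aemeasurable,
    hΛ, lintegral_prod _ hH.lintegral_prod_left.aemeasurable, flightLaw,
    lintegral_map (by fun_prop) (by fun_prop), lintegral_prod _ (by fun_prop),
    ← lintegral_const_mul' _ _ ENNReal.ofReal_ne_top]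
  refine lintegral_congr fun p => ?_
  have hG : Measurable fun q => ∫⁻ s, g s *
      (observed c A s).indicator (1 : (ℝ × ℝ) × (ℝ × ℝ) → ℝ≥0∞) q := hH.lintegral_prod_left
  have hF : Measurable fun y => ∫⁻ s, g s *
      (observed c A s).indicator (1 : (ℝ × ℝ) × (ℝ × ℝ) → ℝ≥0∞) (p, y) :=
    hG.comp measurable_prodMk_left
  rw [lintegral_prod_symm _ hF.aemeasurable,
    lintegral_prod_symm _ (by fun_prop), ← lintegral_const_mul' _ _ ENNReal.ofReal_ne_top]
  refine lintegral_congr fun z => ?_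
  simp only [h2]
  exact lintegral_tail_expMeasure hr (by fun_prop)

theorem measurable_observed_measure (hr : 0 < r) [IsProbabilityMeasure κ] (n : ℕ) {A : Set ℝ}
    (hA : MeasurableSet A) : Measurable fun s =>
      (flightLaw r κ n).prod ((expMeasure r).prod κ) (observed c A s) := by
  have := isProbabilityMeasure_expMeasure hr
  have := isProbabilityMeasure_flightLaw (κ := κ) hr n
  exact measurable_measure_prodMk_left (measurableSet_observed_prod c hA)

/-- The probability of observing the motion during the `(n + 1)`-th displacement. -/
theorem observed_univ_ae_eq (hr : 0 < r) [IsProbabilityMeasure κ] (n : ℕ) :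
    (fun s => ENNReal.ofReal r *
        (flightLaw r κ n).prod ((expMeasure r).prod κ) (observed c univ s)) =ᵐ[volume]
      gammaPDF (n + 1) r := by
  have hm := measurable_observed_measure (c := c) (κ := κ) hr n MeasurableSet.univ
  have hP : Measurable (gammaPDF (n + 1) r) := by unfold gammaPDF; fun_prop
  rw [← withDensity_eq_iff_of_sigmaFinite (hm.const_mul _).aemeasurable hP.aemeasurable,
    ← gammaMeasure, ← map_fst_flightLaw (κ := κ) hr n]
  ext B hB
  have h := lintegral_observed (c := c) (κ := κ) hr n MeasurableSet.univ
    (g := B.indicator 1) (measurable_one.indicator hB)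
  rw [withDensity_apply _ hB, ← lintegral_indicator hB, Measure.map_apply measurable_fst hB,
    ← lintegral_indicator_one (measurable_fst hB)]
  refine Eq.trans (lintegral_congr fun s => ?_) (h.trans (lintegral_congr fun p => ?_))
  · by_cases hs : s ∈ B <;> simp [hs]
  · by_cases hp : p.1 ∈ B <;> simp [hp]

/-- The normalising probability, times `r`, is the Gamma density of shape `n + 1`. Dividing by it
creates `gammaRatio`, and the two factors `r` cancel. -/
theorem lintegral_observed_cond (hr : 0 < r) [IsProbabilityMeasure κ] (n : ℕ)
    {A : Set ℝ} (hA : MeasurableSet A) :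
    ∫⁻ s, ((flightLaw r κ n).prod ((expMeasure r).prod κ) (observed c univ s))⁻¹ *
      (flightLaw r κ n).prod ((expMeasure r).prod κ) (observed c A s) ∂gammaMeasure α t =
        gammaTimeLaw c r t α κ n A := by
  have hmA := measurable_observed_measure (c := c) (κ := κ) hr n hA
  have hmu := measurable_observed_measure (c := c) (κ := κ) hr n MeasurableSet.univ
  have hcA : MeasurableSet ((fun p : ℝ × ℝ => c * p.2) ⁻¹' A) :=
    (by fun_prop : Measurable fun p : ℝ × ℝ => c * p.2) hA
  rw [gammaTimeLaw, Measure.map_apply (by fun_prop) hA, withDensity_apply _ hcA,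
    ← lintegral_indicator hcA, gammaMeasure]
  refine (lintegral_withDensity_eq_lintegral_mul _
    (show Measurable (gammaPDF α t) by unfold gammaPDF; fun_prop) (hmu.inv.mul hmA)).trans ?_
  have h := lintegral_observed (c := c) (κ := κ) hr n hA
    (g := fun s => ENNReal.ofReal (gammaRatio α t (n + 1) r s)) (by fun_prop)
  refine Eq.trans (lintegral_congr_ae ?_) (h.trans (lintegral_congr fun p => ?_))
  · have h0 : ∀ᵐ x : ℝ, x ≠ 0 := by simp [ae_iff]
    filter_upwards [observed_univ_ae_eq (c := c) (κ := κ) hr n, h0] with s hs hs0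
    simp only [Pi.mul_apply, Pi.inv_apply]
    rcases lt_or_gt_of_ne hs0 with hneg | hpos
    · simp [gammaRatio, gammaPDF_of_neg hneg, gammaPDFReal, hneg.not_ge]
    · have hq := gammaPDFReal_pos (a := (n : ℝ) + 1) (by positivity) hr hpos
      have hr0 : ENNReal.ofReal r ≠ 0 := by simpa using hr
      rw [gammaRatio, ENNReal.ofReal_div_of_pos hq]
      change _ = gammaPDF α t s / gammaPDF (n + 1) r s * _
      rw [← hs, ENNReal.div_eq_inv_mul, ENNReal.mul_inv (.inl hr0) (.inl ENNReal.ofReal_ne_top)]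
      have hcancel := ENNReal.inv_mul_cancel hr0 ENNReal.ofReal_ne_top
      calc _ = 1 * (gammaPDF α t s * (_ * _)) := (one_mul _).symm
        _ = _ := by rw [← hcancel]; ring
  · by_cases hp : c * p.2 ∈ A <;> simp [indicator, hp]

end

/-! ### Paths: counting events, position, measurability -/

theorem MeasureTheory.Measure.map_prod_prod_comm {α β γ δ : Type*} [MeasurableSpace α]
    [MeasurableSpace β] [MeasurableSpace γ] [MeasurableSpace δ] (μ : Measure α) (ν : Measure β)
    (ρ : Measure γ) (σ : Measure δ) [SFinite μ] [SFinite ν] [SFinite ρ] [SFinite σ] :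
    ((μ.prod ν).prod (ρ.prod σ)).map (fun p => ((p.1.1, p.2.1), (p.1.2, p.2.2))) =
      (μ.prod ρ).prod (ν.prod σ) := by
  refine Measure.ext_of_lintegral _ fun f hf => ?_
  rw [lintegral_map hf (by fun_prop), lintegral_prod _ (by fun_prop), lintegral_prod _ (by fun_prop),
    lintegral_prod _ (by fun_prop), lintegral_prod _ (by fun_prop)]
  refine lintegral_congr fun a => ?_
  simp only
  have h1 : ∀ b, ∫⁻ q, f ((a, q.1), (b, q.2)) ∂ρ.prod σ =
      ∫⁻ c, ∫⁻ d, f ((a, c), (b, d)) ∂σ ∂ρ := fun b => lintegral_prod _ (by fun_prop)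
  have h2 : ∀ c, ∫⁻ q, f ((a, c), q) ∂ν.prod σ =
      ∫⁻ b, ∫⁻ d, f ((a, c), (b, d)) ∂σ ∂ν := fun c => lintegral_prod _ (by fun_prop)
  simp only [h1, h2]
  exact lintegral_lintegral_swap (by fun_prop)

noncomputable section

/-- The position, for unit speed, at the instant of the `n`-th event. -/
def turningPosition {Ω : Type*} (E θ : ℕ → Ω → ℝ) (n : ℕ) (ω : Ω) : ℝ :=
  ∑ j ∈ Finset.range n, E j ω * Real.cos (θ j ω)

end

section

variable {Ω : Type*} {E θ : ℕ → Ω → ℝ}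

theorem arrivalTime_succ (n : ℕ) (ω : Ω) :
    arrivalTime E (n + 1) ω = arrivalTime E n ω + E n ω := Finset.sum_range_succ _ _

theorem strictMono_arrivalTime {ω : Ω} (h : ∀ j, 0 < E j ω) :
    StrictMono fun k => arrivalTime E k ω :=
  strictMono_nat_of_lt_succ fun k => by rw [arrivalTime_succ]; linarith [h k]

/-- The condition `1 ≤ n` matters: `Set.ncard` is `0` on infinite sets, so only a nonzero count
certifies that finitely many events occurred. -/
theorem eventCount_eq_iff {ω : Ω} (h : ∀ j, 0 < E j ω) {n : ℕ} (hn : 1 ≤ n) (s : ℝ) :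
    eventCount E s ω = n ↔ arrivalTime E n ω ≤ s ∧ s < arrivalTime E (n + 1) ω := by
  have hmono := strictMono_arrivalTime h
  constructor
  · intro hN
    have hfin : {k : ℕ | arrivalTime E (k + 1) ω ≤ s}.Finite :=
      Set.finite_of_ncard_ne_zero (by rw [eventCount] at hN; omega)
    have hlow : ∀ j k : ℕ, j ≤ k → arrivalTime E (k + 1) ω ≤ s → arrivalTime E (j + 1) ω ≤ s :=
      fun j k hjk hk => (hmono.monotone (by omega)).trans hk
    constructor
    · by_contra hlt
      have hsub : {k : ℕ | arrivalTime E (k + 1) ω ≤ s} ⊆ Set.Iio (n - 1) := by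
        intro k hk
        by_contra hkn
        refine hlt ?_
        have := hlow (n - 1) k (by simpa using hkn) hk
        rwa [Nat.sub_add_cancel hn] at this
      have := Set.ncard_le_ncard hsub (Set.finite_Iio _)
      rw [← Finset.coe_Iio, Set.ncard_coe_finset, Nat.card_Iio] at this
      rw [eventCount] at hN
      omega
    · by_contra hlt
      have hsub : Set.Iio (n + 1) ⊆ {k : ℕ | arrivalTime E (k + 1) ω ≤ s} := by
        intro k hk
        exact hlow k n (by simpa [Nat.lt_succ_iff] using hk) (not_lt.1 hlt)
      have := Set.ncard_le_ncard hsub hfin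
      rw [← Finset.coe_Iio, Set.ncard_coe_finset, Nat.card_Iio] at this
      rw [eventCount] at hN
      omega
  · rintro ⟨h1, h2⟩
    have : {k : ℕ | arrivalTime E (k + 1) ω ≤ s} = Set.Iio n := by
      ext k
      simp only [mem_ofPred_eq, mem_Iio]
      constructor
      · intro hk
        have := hmono.lt_iff_lt.1 (hk.trans_lt h2)
        omega
      · intro hk
        exact (hmono.monotone (by omega : k + 1 ≤ n)).trans h1
    rw [eventCount, this, ← Finset.coe_Iio, Set.ncard_coe_finset, Nat.card_Iio]

theorem position_eq_of_eventCount {ω : Ω} {n : ℕ} {s : ℝ} (h : eventCount E s ω = n) (c : ℝ) :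
    position c E θ s ω = c * (turningPosition E θ n ω +
      (s - arrivalTime E n ω) * Real.cos (θ n ω)) := by
  rw [position, h, Finset.sum_range_succ, turningPosition]
  congr 2
  · refine Finset.sum_congr rfl fun j hj => ?_
    have hj' := Finset.mem_range.1 hj
    rw [switchTime, switchTime, h, if_pos (by omega), if_pos hj'.le, arrivalTime_succ]
    ring
  -- The index `n + 1` exceeds the count, so the last endpoint is `s` itself.
  · rw [switchTime, switchTime, h, if_neg (by omega), if_pos le_rfl]

variable [MeasurableSpace Ω]

theorem measurable_arrivalTime (hE : ∀ j, Measurable (E j)) (k : ℕ) :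
    Measurable (arrivalTime E k) := by
  unfold arrivalTime; fun_prop

theorem measurable_eventCount (hE : ∀ j, Measurable (E j)) :
    Measurable fun q : ℝ × Ω => eventCount E q.1 q.2 := by
  have harr : ∀ k, Measurable fun q : ℝ × Ω => arrivalTime E k q.2 := fun k =>
    (measurable_arrivalTime hE k).comp measurable_snd
  have hpos : ∀ n, 1 ≤ n → MeasurableSet ((fun q : ℝ × Ω => eventCount E q.1 q.2) ⁻¹' {n}) := by
    intro n hn
    -- A positive count means that the index set is one of the countably many finite sets of that
    -- size. Level `0` also contains the infinite index sets, so it is treated below as a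
    -- complement.
    have : (fun q : ℝ × Ω => eventCount E q.1 q.2) ⁻¹' {n} =
        ⋃ F ∈ {F : Finset ℕ | F.card = n}, ⋂ k : ℕ,
          {q : ℝ × Ω | k ∈ F ↔ arrivalTime E (k + 1) q.2 ≤ q.1} := by
      ext q
      simp only [mem_preimage, mem_singleton_iff, mem_iUnion, mem_iInter, mem_ofPred_eq,
        exists_prop]
      constructor
      · intro hq
        have hfin : {k : ℕ | arrivalTime E (k + 1) q.2 ≤ q.1}.Finite :=
          Set.finite_of_ncard_ne_zero (by rw [eventCount] at hq; omega)
        refine ⟨hfin.toFinset, ?_, fun k => by simp⟩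
        rw [← hq, eventCount, Set.ncard_eq_toFinset_card _ hfin]
      · rintro ⟨F, hF, hk⟩
        have : {k : ℕ | arrivalTime E (k + 1) q.2 ≤ q.1} = F := by
          ext k; simp [hk k]
        rw [eventCount, this, Set.ncard_coe_finset, hF]
    rw [this]
    refine MeasurableSet.biUnion (Set.to_countable _) fun F _ => MeasurableSet.iInter fun k => ?_
    have hle : MeasurableSet {q : ℝ × Ω | arrivalTime E (k + 1) q.2 ≤ q.1} :=
      measurableSet_le (harr (k + 1)) measurable_fst
    by_cases hk : k ∈ F
    · simpa [hk] using hle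
    · have hlt : MeasurableSet {q : ℝ × Ω | q.1 < arrivalTime E (k + 1) q.2} :=
        measurableSet_lt measurable_fst (harr (k + 1))
      simpa [hk] using hlt
  refine measurable_to_countable' fun n => ?_
  rcases Nat.eq_zero_or_pos n with rfl | hn
  · have : (fun q : ℝ × Ω => eventCount E q.1 q.2) ⁻¹' {0} =
        (⋃ n : ℕ, (fun q : ℝ × Ω => eventCount E q.1 q.2) ⁻¹' {n + 1})ᶜ := by
      ext q
      simp only [mem_preimage, mem_singleton_iff, mem_compl_iff, mem_iUnion, not_exists]
      constructor
      · intro h n; omega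
      · intro h
        by_contra h0
        exact h (eventCount E q.1 q.2 - 1) (by omega)
    rw [this]
    exact (MeasurableSet.iUnion fun n => hpos (n + 1) (by omega)).compl
  · exact hpos n hn

theorem measurable_position (hE : ∀ j, Measurable (E j)) (hθ : ∀ j, Measurable (θ j)) (c : ℝ) :
    Measurable fun q : ℝ × Ω => position c E θ q.1 q.2 := by
  have harr : ∀ k, Measurable fun q : ℝ × Ω => arrivalTime E k q.2 := fun k =>
    (measurable_arrivalTime hE k).comp measurable_snd
  have hN := measurable_eventCount hE
  have hsw : ∀ k, Measurable fun q : ℝ × Ω => switchTime E q.1 k q.2 := fun k =>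
    Measurable.ite (hN (measurableSet_Ici (a := k))) (harr k) measurable_fst
  -- The random number of terms is made a separate countable coordinate.
  have hsum : Measurable fun p : ℕ × (ℝ × Ω) => ∑ j ∈ Finset.range (p.1 + 1),
      (switchTime E p.2.1 (j + 1) p.2.2 - switchTime E p.2.1 j p.2.2) * Real.cos (θ j p.2.2) := by
    refine measurable_from_prod_countable_right fun N => ?_
    have hN : Measurable fun q : ℝ × Ω => ∑ j ∈ Finset.range (N + 1),
        (switchTime E q.1 (j + 1) q.2 - switchTime E q.1 j q.2) * Real.cos (θ j q.2) :=
      Finset.measurable_fun_sum _ fun j _ => ((hsw (j + 1)).sub (hsw j)).mul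
        (Real.measurable_cos.comp ((hθ j).comp measurable_snd))
    exact hN
  have hcomp := hsum.comp (hN.prodMk measurable_id)
  unfold position
  exact hcomp.const_mul c

end

/-! ### Independence and conditional laws -/

theorem ProbabilityTheory.IndepFun.map_prodMk_prodMk {Ω α β γ δ : Type*} [MeasurableSpace Ω]
    [MeasurableSpace α] [MeasurableSpace β] [MeasurableSpace γ] [MeasurableSpace δ]
    {P : Measure Ω} [IsProbabilityMeasure P] {a : Ω → α} {b : Ω → β} {x : Ω → γ} {y : Ω → δ}
    (ha : AEMeasurable a P) (hb : AEMeasurable b P) (hx : AEMeasurable x P)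
    (hy : AEMeasurable y P) (hab : IndepFun a b P) (hxy : IndepFun x y P)
    (h : IndepFun (fun ω => (a ω, b ω)) (fun ω => (x ω, y ω)) P) :
    P.map (fun ω => ((a ω, x ω), (b ω, y ω))) =
      (P.map fun ω => (a ω, x ω)).prod (P.map fun ω => (b ω, y ω)) := by
  have hax : IndepFun a x P := h.comp measurable_fst measurable_fst
  have hby : IndepFun b y P := h.comp measurable_snd measurable_snd
  rw [hax.map_prod_eq_prod_map_map ha hx, hby.map_prod_eq_prod_map_map hb hy,
    ← Measure.map_prod_prod_comm, ← hab.map_prod_eq_prod_map_map ha hb,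
    ← hxy.map_prod_eq_prod_map_map hx hy,
    ← h.map_prod_eq_prod_map_map (ha.prodMk hb) (hx.prodMk hy),
    AEMeasurable.map_map_of_aemeasurable (by fun_prop)
      ((ha.prodMk hb).prodMk (hx.prodMk hy))]
  rfl

/-- If `D` is independent of `X`, the conditional law of `Φ (X, D)` given `X = s` is the law of
`Φ (s, D)`. -/
theorem ProbabilityTheory.condDistrib_ae_eq_of_indepFun {Ω β γ δ : Type*} [MeasurableSpace Ω]
    [MeasurableSpace β] [MeasurableSpace γ] [MeasurableSpace δ] [StandardBorelSpace δ] [Nonempty δ]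
    {P : Measure Ω} [IsProbabilityMeasure P] {X : Ω → β} {D : Ω → γ} {Φ : β × γ → δ}
    (hX : AEMeasurable X P) (hD : AEMeasurable D P) (hΦ : Measurable Φ) (hind : IndepFun X D P) :
    ∀ᵐ s ∂P.map X, ∀ B : Set δ, MeasurableSet B →
      condDistrib (fun ω => Φ (X ω, D ω)) X P s B = P {ω | Φ (s, D ω) ∈ B} := by
  have := Measure.isProbabilityMeasure_map hD
  have := Measure.isProbabilityMeasure_map hX
  have hκ : ∀ s B, MeasurableSet B →
      (Kernel.id ×ₖ Kernel.const β (P.map D)).map Φ s B = P {ω | Φ (s, D ω) ∈ B} := by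
    intro s B hB
    rw [Kernel.map_apply' _ hΦ _ hB, Kernel.prod_apply, Kernel.id_apply, Kernel.const_apply,
      Measure.dirac_prod, Measure.map_apply (by fun_prop) (hΦ hB),
      Measure.map_apply_of_aemeasurable hD (measurable_prodMk_left (hΦ hB))]
    rfl
  have : IsMarkovKernel ((Kernel.id ×ₖ Kernel.const β (P.map D)).map Φ) :=
    Kernel.IsMarkovKernel.map _ hΦ
  have hΨ : Measurable fun q : β × γ => (q.1, Φ q) := measurable_fst.prodMk hΦ
  -- The kernel sending `s` to the law of `Φ (s, D)` disintegrates the joint law; uniqueness of the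
  -- disintegration identifies it with `condDistrib`.
  have hjoint : P.map (fun ω => (X ω, Φ (X ω, D ω))) =
      P.map X ⊗ₘ (Kernel.id ×ₖ Kernel.const β (P.map D)).map Φ := by
    have h1 : P.map (fun ω => (X ω, Φ (X ω, D ω))) =
        ((P.map X).prod (P.map D)).map fun q => (q.1, Φ q) := by
      rw [← hind.map_prod_eq_prod_map_map hX hD,
        AEMeasurable.map_map_of_aemeasurable hΨ.aemeasurable (hX.prodMk hD)]
      rfl
    rw [h1]
    ext S hS
    rw [Measure.map_apply hΨ hS, Measure.prod_apply (hΨ hS), Measure.compProd_apply hS]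
    refine lintegral_congr fun s => ?_
    rw [hκ s _ (measurable_prodMk_left hS),
      Measure.map_apply_of_aemeasurable hD (measurable_prodMk_left (hΨ hS))]
    rfl
  filter_upwards [condDistrib_ae_eq_of_measure_eq_compProd X
    (hΦ.comp_aemeasurable (hX.prodMk hD)) hjoint] with s hs B hB
  rw [← hκ s B hB, ← hs]
  rfl

/-! ### The law of the motion -/

section

variable {Ω : Type*} [MeasurableSpace Ω] {P : Measure Ω} {lam ν : ℝ} {E θ : ℕ → Ω → ℝ}

theorem IsMotionData.aemeasurable_wait (h : IsMotionData P lam ν E θ) (j : ℕ) :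
    AEMeasurable (E j) P := (h.law_wait j).aemeasurable

theorem IsMotionData.aemeasurable_angle (h : IsMotionData P lam ν E θ) (j : ℕ) :
    AEMeasurable (θ j) P := (h.law_angle j).aemeasurable

theorem IsMotionData.aemeasurable_cos (h : IsMotionData P lam ν E θ) (j : ℕ) :
    AEMeasurable (fun ω => Real.cos (θ j ω)) P :=
  Real.measurable_cos.comp_aemeasurable (h.aemeasurable_angle j)

theorem IsMotionData.aemeasurable_past (h : IsMotionData P lam ν E θ) (n : ℕ) :
    AEMeasurable (fun ω => (arrivalTime E n ω, turningPosition E θ n ω)) P := by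
  have hE := h.aemeasurable_wait
  have hθ := h.aemeasurable_angle
  unfold arrivalTime turningPosition
  fun_prop

theorem IsMotionData.ae_wait_pos (h : IsMotionData P lam ν E θ) :
    ∀ᵐ ω ∂P, ∀ j, 0 < E j ω :=
  ae_all_iff.2 fun j => ae_of_ae_map (h.aemeasurable_wait j) (by
    rw [(h.law_wait j).map_eq]; exact ae_pos_gammaMeasure 1 lam)

variable [IsProbabilityMeasure P]

theorem IsMotionData.isProbabilityMeasure_angleLaw (h : IsMotionData P lam ν E θ) :
    IsProbabilityMeasure (angleLaw ν) := by
  rw [← (h.law_angle 0).map_eq]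
  exact Measure.isProbabilityMeasure_map (h.law_angle 0).aemeasurable

theorem IsMotionData.isProbabilityMeasure_cosLaw (h : IsMotionData P lam ν E θ) :
    IsProbabilityMeasure (cosLaw ν) := by
  have := h.isProbabilityMeasure_angleLaw
  exact Measure.isProbabilityMeasure_map Real.measurable_cos.aemeasurable

theorem IsMotionData.map_wait_cos (h : IsMotionData P lam ν E θ) (n : ℕ) :
    P.map (fun ω => (E n ω, Real.cos (θ n ω))) = (expMeasure lam).prod (cosLaw ν) := by
  have hind : IndepFun (E n) (fun ω => Real.cos (θ n ω)) P :=
    h.indep_wait_angle.comp (measurable_pi_apply n)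
      (Real.measurable_cos.comp (measurable_pi_apply n))
  rw [hind.map_prod_eq_prod_map_map (h.aemeasurable_wait n)
    (h.aemeasurable_cos n), (h.law_wait n).map_eq,
    cosLaw, ← (h.law_angle n).map_eq,
    AEMeasurable.map_map_of_aemeasurable (by fun_prop) (h.aemeasurable_angle n)]
  rfl

/-- The first `n` waiting times and angles are independent of the next pair. This is assembled from
independence within each sequence and between the two, before passing to sums. -/
theorem IsMotionData.map_past_prod (h : IsMotionData P lam ν E θ) (n : ℕ) :
    P.map (fun ω => ((arrivalTime E n ω, turningPosition E θ n ω),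
        (E n ω, Real.cos (θ n ω)))) =
      (P.map fun ω => (arrivalTime E n ω, turningPosition E θ n ω)).prod
        ((expMeasure lam).prod (cosLaw ν)) := by
  have hE := h.aemeasurable_wait
  have hθ := h.aemeasurable_angle
  have hdis : Disjoint (Finset.range n) {n} := by simp
  have hn : n ∈ ({n} : Finset ℕ) := by simp
  have hpE : AEMeasurable (fun ω (i : Finset.range n) => E i ω) P :=
    aemeasurable_pi_lambda _ fun i => hE i
  have hpθ : AEMeasurable (fun ω (i : Finset.range n) => θ i ω) P :=
    aemeasurable_pi_lambda _ fun i => hθ i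
  have hEi : IndepFun (fun ω (i : Finset.range n) => E i ω) (E n) P :=
    (h.indep_wait.indepFun_finset₀ _ _ hdis hE).comp measurable_id
      (measurable_pi_apply (⟨n, hn⟩ : ({n} : Finset ℕ)))
  have hθi : IndepFun (fun ω (i : Finset.range n) => θ i ω) (θ n) P :=
    (h.indep_angle.indepFun_finset₀ _ _ hdis hθ).comp measurable_id
      (measurable_pi_apply (⟨n, hn⟩ : ({n} : Finset ℕ)))
  have hsplit : Measurable fun d : ℕ → ℝ => ((fun i : Finset.range n => d i), d n) := by fun_prop
  have key := IndepFun.map_prodMk_prodMk hpE (hE n) hpθ (hθ n) hEi hθi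
    (h.indep_wait_angle.comp hsplit hsplit)
  have hf : Measurable fun p : (Finset.range n → ℝ) × (Finset.range n → ℝ) =>
      ((∑ i, p.1 i, ∑ i, p.1 i * Real.cos (p.2 i)) : ℝ × ℝ) := by fun_prop
  have hg : Measurable fun p : ℝ × ℝ => (p.1, Real.cos p.2) := by fun_prop
  have hpair := hpE.prodMk hpθ
  have hlast := (hE n).prodMk (hθ n)
  have := Measure.isProbabilityMeasure_map hpair
  have hmap := congrArg (Measure.map (Prod.map (fun p : (Finset.range n → ℝ) ×
    (Finset.range n → ℝ) => ((∑ i, p.1 i, ∑ i, p.1 i * Real.cos (p.2 i)) : ℝ × ℝ))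
      (fun p : ℝ × ℝ => (p.1, Real.cos p.2)))) key
  rw [← Measure.map_prod_map _ _ hf hg,
    AEMeasurable.map_map_of_aemeasurable (hf.prodMap hg).aemeasurable (hpair.prodMk hlast),
    AEMeasurable.map_map_of_aemeasurable hf.aemeasurable hpair,
    AEMeasurable.map_map_of_aemeasurable hg.aemeasurable hlast] at hmap
  rw [← h.map_wait_cos n]
  have hsum : ∀ ω, (∑ i : Finset.range n, E i ω, ∑ i : Finset.range n, E i ω * Real.cos (θ i ω)) =
      (arrivalTime E n ω, turningPosition E θ n ω) := fun ω => by
    rw [arrivalTime, turningPosition, Finset.sum_coe_sort (Finset.range n) (fun i => E i ω),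
      Finset.sum_coe_sort (Finset.range n) (fun i => E i ω * Real.cos (θ i ω))]
  simp only [← hsum]
  exact hmap

theorem IsMotionData.map_past (h : IsMotionData P lam ν E θ) (n : ℕ) :
    P.map (fun ω => (arrivalTime E n ω, turningPosition E θ n ω)) =
      flightLaw lam (cosLaw ν) n := by
  induction n with
  | zero => simp [arrivalTime, turningPosition, flightLaw, Measure.map_const, Prod.mk_zero_zero]
  | succ n ih =>
    rw [flightLaw, ← ih, ← h.map_past_prod n, AEMeasurable.map_map_of_aemeasurable
      measurable_flightStep.aemeasurable ((h.aemeasurable_past n).prodMk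
        ((h.aemeasurable_wait n).prodMk
          (h.aemeasurable_cos n)))]
    congr 1
    funext ω
    simp [flightStep, arrivalTime, turningPosition, Finset.sum_range_succ]

theorem IsMotionData.map_observed (h : IsMotionData P lam ν E θ) (n : ℕ) :
    P.map (fun ω => ((arrivalTime E n ω, turningPosition E θ n ω),
        (E n ω, Real.cos (θ n ω)))) =
      (flightLaw lam (cosLaw ν) n).prod ((expMeasure lam).prod (cosLaw ν)) := by
  rw [h.map_past_prod, h.map_past]

/-- The joint law of the number of events and the position at a fixed time. -/
theorem IsMotionData.measure_eventCount_position (h : IsMotionData P lam ν E θ) {n : ℕ}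
    (hn : 1 ≤ n) (c s : ℝ) {A : Set ℝ} (hA : MeasurableSet A) :
    P {ω | eventCount E s ω = n ∧ position c E θ s ω ∈ A} =
      (flightLaw lam (cosLaw ν) n).prod ((expMeasure lam).prod (cosLaw ν)) (observed c A s) := by
  rw [← h.map_observed, Measure.map_apply_of_aemeasurable ((h.aemeasurable_past n).prodMk
        ((h.aemeasurable_wait n).prodMk
          (h.aemeasurable_cos n)))
      (measurableSet_observed c hA s)]
  refine measure_congr ?_
  filter_upwards [h.ae_wait_pos] with ω hω
  refine propext ?_
  change eventCount E s ω = n ∧ position c E θ s ω ∈ A ↔ arrivalTime E n ω ≤ s ∧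
    s < arrivalTime E n ω + E n ω ∧ c * (turningPosition E θ n ω +
      (s - arrivalTime E n ω) * Real.cos (θ n ω)) ∈ A
  rw [← arrivalTime_succ, ← and_assoc, ← eventCount_eq_iff hω hn]
  exact and_congr_right fun hs => by rw [position_eq_of_eventCount hs]

/-- Given an independent observation time, the conditional law of the number of events and the
position is their law at the corresponding fixed time. -/
theorem IsMotionData.condDistrib_ae_eq (h : IsMotionData P lam ν E θ) (c : ℝ) {G : Ω → ℝ}
    (hG : AEMeasurable G P)
    (hind : IndepFun G (fun ω => ((fun j => E j ω), (fun j => θ j ω))) P) :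
    ∀ᵐ s ∂P.map G, ∀ B : Set (ℕ × ℝ), MeasurableSet B →
      condDistrib (fun ω => (eventCount E (G ω) ω, position c E θ (G ω) ω)) G P s B =
        P {ω | (eventCount E s ω, position c E θ s ω) ∈ B} := by
  have hD : AEMeasurable (fun ω => ((fun j => E j ω), (fun j => θ j ω))) P :=
    (aemeasurable_pi_lambda _ h.aemeasurable_wait).prodMk
      (aemeasurable_pi_lambda _ h.aemeasurable_angle)
  -- The data are only almost everywhere measurable on `Ω`. Count and position are therefore
  -- regarded as functions on the space of sequences, where the coordinates are measurable.
  have hc1 : ∀ j, Measurable fun d : (ℕ → ℝ) × (ℕ → ℝ) => d.1 j := fun j => by fun_prop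
  have hc2 : ∀ j, Measurable fun d : (ℕ → ℝ) × (ℕ → ℝ) => d.2 j := fun j => by fun_prop
  exact condDistrib_ae_eq_of_indepFun hG hD
    ((measurable_eventCount hc1).prodMk (measurable_position hc1 hc2 c)) hind

theorem IsMotionData.randomTimeCondProb_eq (h : IsMotionData P lam ν E θ) {n : ℕ} (hn : 1 ≤ n)
    (c : ℝ) {G : Ω → ℝ} (hG : AEMeasurable G P)
    (hind : IndepFun G (fun ω => ((fun j => E j ω), (fun j => θ j ω))) P) {A : Set ℝ}
    (hA : MeasurableSet A) :
    randomTimeCondProb P (position c E θ) (eventCount E) G n A =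
      ∫⁻ s, ((flightLaw lam (cosLaw ν) n).prod ((expMeasure lam).prod (cosLaw ν))
          (observed c univ s))⁻¹ *
        (flightLaw lam (cosLaw ν) n).prod ((expMeasure lam).prod (cosLaw ν)) (observed c A s)
          ∂P.map G := by
  have hmn : MeasurableSet {p : ℕ × ℝ | p.1 = n} := measurable_fst (measurableSet_singleton n)
  have hmA : MeasurableSet {p : ℕ × ℝ | p.2 ∈ A} := measurable_snd hA
  refine lintegral_congr_ae ?_
  -- The exceptional null set of times does not depend on the event, so `hs` serves both the
  -- numerator and the normalisation.
  filter_upwards [h.condDistrib_ae_eq c hG hind] with s hs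
  rw [cond_apply hmn, hs _ hmn, hs _ (hmn.inter hmA),
    ← h.measure_eventCount_position hn c s hA,
    ← h.measure_eventCount_position hn c s MeasurableSet.univ]
  simp

end

/-! ### Conclusion -/

theorem theorem8 {Ω : Type*} [MeasurableSpace Ω] (P : Measure Ω) [IsProbabilityMeasure P]
    (c lam t α : ℝ) (hc : 0 < c) (hlam : 0 < lam) (ht : 0 < t) (hα : 0 < α)
    (m : Fin 2) (n : ℕ) (hn : 1 ≤ n)
    (E θ : ℕ → Ω → ℝ) (hmotion : IsMotionData P lam ((m : ℕ) : ℝ) E θ)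
    (G : Ω → ℝ) (hG : HasLaw G (gammaMeasure α t) P)
    (hindep : IndepFun G (fun ω => ((fun j => E j ω), (fun j => θ j ω))) P)
    (hv : α / 2 - 1 < motionIndex m n) :
    (∀ A : Set ℝ, MeasurableSet A →
      randomTimeCondProb P (position c E θ) (eventCount E) G n A =
        ∫⁻ x in A, ENNReal.ofReal (gammaTimeDensity c t α (motionIndex m n) x)) ∧
    (∀ A : Set ℝ, MeasurableSet A →
      randomTimeCondProb P (position c E θ) (eventCount E) G n A =
        ∫⁻ z, ∫⁻ w, gaussianReal 0 (Real.toNNReal (2 * c ^ 2 / t ^ 2 * (z * w))) A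
          ∂(betaMeasure (α / 2) (motionIndex m n - α / 2 + 1))
          ∂(gammaMeasure ((α + 1) / 2) 1)) := by
  have := hmotion.isProbabilityMeasure_cosLaw
  have key : ∀ A : Set ℝ, MeasurableSet A →
      randomTimeCondProb P (position c E θ) (eventCount E) G n A =
        gaussianMixture (2 * c ^ 2 / t ^ 2) ((α + 1) / 2) (α / 2)
          (motionIndex m n - α / 2 + 1) A := fun A hA => by
    rw [hmotion.randomTimeCondProb_eq hn c hG.aemeasurable hindep hA, hG.map_eq,
      lintegral_observed_cond hlam n hA, gammaTimeLaw_eq_gaussianMixture hc hlam hα ht m n hv]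
  refine ⟨fun A hA => ?_, fun A hA => ?_⟩
  · rw [key A hA, gaussianMixture_eq_lintegral hc ht hα hv hA]
  · rw [key A hA, gaussianMixture_apply (by linarith) (by linarith) (by linarith) hA]
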